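/- Conventions. Write $2^{<\mathbb N}$ for the finite binary strings, $\Lambda$ for the empty string, and $\sigma\prec X$ when $\sigma$ is a prefix of $X\in 2^{\mathbb N}$. A $\Pi^0_1$ class is a set of the form $\{X\in2^{\mathbb N} : \sigma\not\prec X \text{ for all } \sigma\in S\}$ with $S\subseteq 2^{<\mathbb N}$ computably enumerable. The canonical tree of $\mathcal C\subseteq 2^{\mathbb N}$ is $T=\{\sigma : \sigma\prec X \text{ for some } X\in\mathcal C\}$, and $T_n$ is the set of its strings of length $n$. A continuous semi-measure is a function $\rho:2^{<\mathbb N}\to[0,1]$ with $\rho(\Lambda)=1$ and $\rho(\sigma)\ge\rho(\sigma0)+\rho(\sigma1)$ for all $\sigma$; it is lower semi-computable if it is the pointwise limit of a (uniformly) computable non-decreasing sequence of dyadic-rational-valued functions. It is a universal lower semi-computable continuous semi-measure if, moreover, for every lower semi-computable continuous semi-measure $\rho'$ there is $c\in\mathbb N$ with $\rho'\le c\cdot\rho$. Fix such a universal $\mathbf M$, and put $\mathbf M(S)=\sum_{\sigma\in S}\mathbf M(\sigma)$. A class $\mathcal C\subseteq 2^{\mathbb N}$ with canonical tree $T$ is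 deep if there is a computable, non-decreasing, unbounded $h:\mathbb N\to\mathbb N$ with $\mathbf M(T_n)\le 2^{-h(n)}$ for all $n$. Theorem. Let $(\phi_e)_{e\in\mathbb N}$ be a uniformly partial computable enumeration of all $\{0,1\}$-valued partial computable functions, and let $u$ be a partial computable $\{0,1\}$-valued function that is universal for it: for some computable $g:\mathbb N^2\to\mathbb N$, $u(g(e,x))\simeq\phi_e(x)$ for all $e,x$ (for example, $u(\langle e,x\rangle)\simeq\phi_e(x)$). Then the class $\mathcal C$ of total $\{0,1\}$-valued functions that extend $u$ is a $\Pi^0_1$ class, and it is deep. Furthermore, the class of consistent completions of first-order Peano arithmetic (that is, of complete consistent theories containing its axioms, each identified with the characteristic function of its set of Gödel numbers) is deep. -/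

import Mathlib

namespace DeepClass

/-! ### Strings, sequences, effectively closed classes -/

/-- The string `σ` is a prefix of the infinite binary sequence `X`. -/
def IsPrefixOf (σ : List Bool) (X : ℕ → Bool) : Prop :=
  ∀ (i : ℕ) (h : i < σ.length), σ[i] = X i

/-- Effectively closed classes: complements of unions of cylinders over a c.e. set of strings. -/
def IsPi01Class (C : Set (ℕ → Bool)) : Prop :=
  ∃ S : Set (List Bool), REPred (fun σ => σ ∈ S) ∧
    C = {X | ∃ σ ∈ S, IsPrefixOf σ X}ᶜ

/-- The canonical tree of `C`: all prefixes of members of `C`. -/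
def canonicalTree (C : Set (ℕ → Bool)) : Set (List Bool) :=
  {σ | ∃ X ∈ C, IsPrefixOf σ X}

/-- The set of members of length `n` of a set of strings. -/
def level (T : Set (List Bool)) (n : ℕ) : Set (List Bool) :=
  {σ | σ ∈ T ∧ σ.length = n}

theorem level_finite (T : Set (List Bool)) (n : ℕ) : (level T n).Finite :=
  (List.finite_length_eq Bool n).subset fun _ h => h.2

/-! ### Lower semi-computable continuous semi-measures -/

/-- Continuous semi-measures on finite binary strings. -/
structure IsContinuousSemimeasure (ρ : List Bool → ℝ) : Prop where
  mem_Icc : ∀ σ, ρ σ ∈ Set.Icc (0 : ℝ) 1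
  root : ρ [] = 1
  split : ∀ σ, ρ (σ ++ [false]) + ρ (σ ++ [true]) ≤ ρ σ

/-- A nonnegative function on strings is lower semi-computable if it is the pointwise limit of a
computable non-decreasing sequence of (nonnegative) dyadic rationals; the pair `(a, b)` stands
for the dyadic rational `a / 2 ^ b`. -/
def IsLowerSemicomputable (ρ : List Bool → ℝ) : Prop :=
  ∃ q : List Bool → ℕ → ℕ × ℕ, Computable₂ q ∧
    ∀ σ, Monotone (fun s => ((q σ s).1 : ℝ) / 2 ^ (q σ s).2) ∧
      Filter.Tendsto (fun s => ((q σ s).1 : ℝ) / 2 ^ (q σ s).2) Filter.atTop (nhds (ρ σ))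

/-- `M` is a universal lower semi-computable continuous semi-measure: it is one, and it dominates
every other one up to a multiplicative constant. -/
structure IsUniversalSemimeasure (M : List Bool → ℝ) : Prop where
  semimeasure : IsContinuousSemimeasure M
  lowerSemicomputable : IsLowerSemicomputable M
  universal : ∀ ρ : List Bool → ℝ, IsContinuousSemimeasure ρ → IsLowerSemicomputable ρ →
    ∃ c : ℕ, ∀ σ, ρ σ ≤ c * M σ

/-- The weight `ρ(S)`, the sum of `ρ` over a (finite) set `S` of strings. -/
noncomputable def weight (ρ : List Bool → ℝ) (S : Set (List Bool)) : ℝ :=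
  ∑ᶠ σ ∈ S, ρ σ

/-! ### Depth -/

/-- Computable order functions. -/
structure IsComputableOrder (h : ℕ → ℕ) : Prop where
  computable : Computable h
  monotone : Monotone h
  unbounded : ∀ k, ∃ n, k ≤ h n

/-- Depth of a class with respect to `M`: the weight of the `n`-th level of its canonical tree
is at most `2 ^ (-h n)` for some computable order `h`. -/
def IsDeep (M : List Bool → ℝ) (C : Set (ℕ → Bool)) : Prop :=
  ∃ h : ℕ → ℕ, IsComputableOrder h ∧
    ∀ n, weight M (level (canonicalTree C) n) ≤ (1 / 2 : ℝ) ^ h n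

/-! ### Universal partial computable `{0,1}`-valued functions -/

/-- `φ` is an effective (uniformly partial computable) enumeration of all partial computable
`{0,1}`-valued functions. -/
structure IsEffectiveEnumeration (φ : ℕ → ℕ →. Bool) : Prop where
  partrec : Partrec₂ φ
  exhaustive : ∀ ψ : ℕ →. Bool, Partrec ψ → ∃ e, φ e = ψ

/-- `u` is a partial computable function universal for the family `φ`: it computes `φ e x` from a
computable code of the pair `(e, x)`. The code `Nat.pair e x` is the basic example. -/
structure IsUniversalFor (u : ℕ →. Bool) (φ : ℕ → ℕ →. Bool) : Prop where
  partrec : Partrec u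
  simulates : ∃ g : ℕ → ℕ → ℕ, Computable₂ g ∧ ∀ e x, u (g e x) = φ e x

/-- The class of total `{0,1}`-valued extensions of `u`. -/
def totalExtensions (u : ℕ →. Bool) : Set (ℕ → Bool) :=
  {X | ∀ n, ∀ b ∈ u n, X n = b}

/-! ### Peano arithmetic -/

open FirstOrder FirstOrder.Language

/-- Function symbols of arithmetic. -/
inductive ArithFunc : ℕ → Type
  | zero : ArithFunc 0
  | succ : ArithFunc 1
  | add : ArithFunc 2
  | mul : ArithFunc 2

/-- The language `0, S, +, ·` of arithmetic (with equality). -/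
abbrev arith : FirstOrder.Language.{0, 0} := ⟨ArithFunc, fun _ => Empty⟩

section Terms

variable {α : Type}

def tZero : arith.Term α := Term.func (L := arith) ArithFunc.zero ![]
def tSucc (t : arith.Term α) : arith.Term α := Term.func (L := arith) ArithFunc.succ ![t]
def tAdd (t s : arith.Term α) : arith.Term α := Term.func (L := arith) ArithFunc.add ![t, s]
def tMul (t s : arith.Term α) : arith.Term α := Term.func (L := arith) ArithFunc.mul ![t, s]

end Terms

/-- The universal closure of a formula in the variables `0, …, n - 1`. -/
def closure {n : ℕ} (φ : arith.Formula (Fin n)) : arith.Sentence :=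
  BoundedFormula.alls (n := n) (BoundedFormula.relabel (Sum.inr : Fin n → Empty ⊕ Fin n) φ)

/-- `φ(x₀, …, xₙ₋₁, t)` for a formula `φ` in the variables `0, …, n`. -/
def substLast {n m : ℕ} (φ : arith.Formula (Fin (n + 1))) (v : Fin n → Fin m)
    (t : arith.Term (Fin m)) : arith.Formula (Fin m) :=
  BoundedFormula.subst φ (Fin.snoc (α := fun _ => arith.Term (Fin m)) (fun i => Term.var (v i)) t)

/-- `∀ xₙ, φ(x₀, …, xₙ)` for a formula `φ` in the variables `0, …, n`. -/
def allLast {n : ℕ} (φ : arith.Formula (Fin (n + 1))) : arith.Formula (Fin n) :=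
  BoundedFormula.all (n := 0) (BoundedFormula.relabel (n := 1) (k := 0)
    (Fin.snoc (α := fun _ => Fin n ⊕ Fin 1) Sum.inl (Sum.inr 0)) φ)

/-- The induction axiom for `φ`, on its last variable, with the other variables as parameters:
the universal closure of `φ(0) → (∀ x, φ(x) → φ(S x)) → ∀ x, φ(x)`. -/
def inductionAxiom {n : ℕ} (φ : arith.Formula (Fin (n + 1))) : arith.Sentence :=
  closure <|
    (substLast φ id tZero).imp <|
      (allLast (φ.imp (substLast φ Fin.castSucc (tSucc (Term.var (Fin.last n)))))).imp
        (allLast φ)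

/-- The axioms of first-order Peano arithmetic. -/
inductive PeanoAxiom : arith.Sentence → Prop
  | succ_ne_zero : PeanoAxiom (closure (n := 1)
      ((tSucc (Term.var 0)).equal tZero).not)
  | succ_inj : PeanoAxiom (closure (n := 2)
      (((tSucc (Term.var 0)).equal (tSucc (Term.var 1))).imp
        ((Term.var 0 : arith.Term (Fin 2)).equal (Term.var 1))))
  | add_zero : PeanoAxiom (closure (n := 1)
      ((tAdd (Term.var 0) tZero).equal (Term.var 0)))
  | add_succ : PeanoAxiom (closure (n := 2)
      ((tAdd (Term.var 0) (tSucc (Term.var 1))).equal (tSucc (tAdd (Term.var 0) (Term.var 1)))))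
  | mul_zero : PeanoAxiom (closure (n := 1)
      ((tMul (Term.var 0) tZero).equal tZero))
  | mul_succ : PeanoAxiom (closure (n := 2)
      ((tMul (Term.var 0) (tSucc (Term.var 1))).equal
        (tAdd (tMul (Term.var 0) (Term.var 1)) (Term.var 0))))
  | induction {n : ℕ} (φ : arith.Formula (Fin (n + 1))) : PeanoAxiom (inductionAxiom φ)

/-- First-order Peano arithmetic. -/
def peano : arith.Theory := {φ | PeanoAxiom φ}

/-- Code of a function symbol applied to arguments with given codes. -/
def codeFunc : {k : ℕ} → ArithFunc k → (Fin k → ℕ) → ℕ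
  | _, .zero, _ => Nat.pair 1 0
  | _, .succ, c => Nat.pair 2 (c 0)
  | _, .add, c => Nat.pair 3 (Nat.pair (c 0) (c 1))
  | _, .mul, c => Nat.pair 4 (Nat.pair (c 0) (c 1))

/-- Gödel numbers of terms (in the variables of a sentence's subformula). -/
def codeTerm {n : ℕ} : arith.Term (Empty ⊕ Fin n) → ℕ
  | .var (Sum.inl e) => e.elim
  | .var (Sum.inr i) => Nat.pair 0 i
  | .func f ts => codeFunc f (fun i => codeTerm (ts i))

/-- Gödel numbers of formulas without free variables other than the de Bruijn levels below `n`. -/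
def codeFormula : {n : ℕ} → arith.BoundedFormula Empty n → ℕ
  | _, .falsum => Nat.pair 0 0
  | _, .equal t s => Nat.pair 1 (Nat.pair (codeTerm t) (codeTerm s))
  | _, .rel R _ => Empty.elim R
  | _, .imp φ ψ => Nat.pair 2 (Nat.pair (codeFormula φ) (codeFormula ψ))
  | _, .all φ => Nat.pair 3 (codeFormula φ)

/-- The Gödel number of a sentence of arithmetic. -/
def godelNumber (φ : arith.Sentence) : ℕ := codeFormula φ

/-- The class of (characteristic functions of the sets of Gödel numbers of) consistent completions
of Peano arithmetic. `T.IsMaximal` says that `T` is satisfiable, that is, consistent, and contains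
every sentence or its negation. -/
def consistentCompletionsPA : Set (ℕ → Bool) :=
  {X | ∃ T : arith.Theory, peano ⊆ T ∧ T.IsMaximal ∧
    ∀ k, X k = true ↔ ∃ φ ∈ T, godelNumber φ = k}

end DeepClass

namespace DeepClass

/-! ### Computability of bounded sums and bounded quantifiers -/

section Computability

variable {α : Type*} [Primcodable α]

/-! Depth comes from a diagonalization against `M` itself. Suppose a computable `G` locates, in
every member of `C`, the values of the universal function (`isDeep_of_computes_extensions`). By the
recursion theorem, take a program `c` that knows its own code, hence the places where members of `C`
must record its outputs. Give it, for each `k`, a block of `2 ^ (k + 1) + 1` inputs. On the `i`-th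
of them it enumerates `M` from below on strings of a computable length covering the whole block. It
waits for a bit `b` such that the strings agreeing with its first `i` outputs and carrying `b` at
the `i`-th place weigh more than `2 ^ (-(k + 1))`; it then outputs the opposite bit.

Every halt discards more than `2 ^ (-(k + 1))` of a total weight at most `1`
(`sum_agreeing_succ_le`), so some input of the block diverges. At the least such input the surviving
strings of either bit weigh at most `2 ^ (-(k + 1))`, hence at most `2 ^ (-k)` together
(`sum_agreeing_le_of_not_dom`). Prefixes of members of `C` all survive. Small weight at computably
many levels then yields a computable order (`isDeep_of_levels`).

For Peano arithmetic, a Rosser formula decides the universal function correctly, wherever it is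
defined, in every model of Robinson's axioms (`exists_deciding_formula`). A completion is the full
theory of a model, so it records these values at computable Gödel numbers. The formula exists
because partial recursive graphs are projections of relations whose truth at numerals is the same in
all such models (`ExistentialGraph.of_partrec`). -/

theorem computable_sum_range {n : α → ℕ} {f : α → ℕ → ℕ} (hn : Computable n)
    (hf : Computable₂ f) : Computable fun a => ∑ j ∈ Finset.range (n a), f a j := by
  have hadd : Computable₂ ((· + ·) : ℕ → ℕ → ℕ) := Primrec.nat_add.to_comp
  have hstep : Computable₂ fun (a : α) (p : ℕ × ℕ) => p.2 + f a p.1 :=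
    hadd.comp (Computable.snd.comp Computable.snd)
      (hf.comp Computable.fst (Computable.fst.comp Computable.snd))
  refine (Computable.nat_rec hn (Computable.const 0) hstep).of_eq fun a => ?_
  induction n a with
  | zero => rfl
  | succ m ih => rw [Finset.sum_range_succ, ← ih]

theorem computable_ball_lt {n : α → ℕ} {p : α → ℕ → Bool} (hn : Computable n)
    (hp : Computable₂ p) : Computable fun a => decide (∀ j < n a, p a j = true) := by
  have hand : Computable₂ and := Primrec.and.to_comp
  have hstep : Computable₂ fun (a : α) (q : ℕ × Bool) => q.2 && p a q.1 :=
    hand.comp (Computable.snd.comp Computable.snd)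
      (hp.comp Computable.fst (Computable.fst.comp Computable.snd))
  refine (Computable.nat_rec hn (Computable.const true) hstep).of_eq fun a => ?_
  induction n a with
  | zero => simp
  | succ m ih =>
    simp only [ih, Nat.forall_lt_succ_right]
    rw [Bool.eq_iff_iff]; simp

theorem computable_decide_eq {β : Type*} [Primcodable β] [DecidableEq β] {f g : α → β}
    (hf : Computable f) (hg : Computable g) : Computable fun a => decide (f a = g a) := by
  have h : Computable₂ fun a b : β => decide (a = b) := (Primrec.eq (α := β)).decide.to_comp
  exact h.comp hf hg

theorem computable_and {f g : α → Bool} (hf : Computable f) (hg : Computable g) :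
    Computable fun a => f a && g a := by
  have h : Computable₂ and := Primrec.and.to_comp
  exact h.comp hf hg

theorem computable_two_pow {f : α → ℕ} (hf : Computable f) : Computable fun a => 2 ^ f a := by
  have h : Computable₂ fun a b : ℕ => a ^ b := (Primrec₂.unpaired'.1 Nat.Primrec.pow).to_comp
  exact h.comp (Computable.const 2) hf

end Computability

/-! ### Weights -/

theorem weight_eq_sum (ρ : List Bool → ℝ) {S : Set (List Bool)} (hS : S.Finite) :
    weight ρ S = ∑ σ ∈ hS.toFinset, ρ σ :=
  finsum_mem_eq_finite_toFinset_sum _ hS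

/-- Grouping level `n + 1` by `dropLast`, each fibre lies in the two children of a string of level
`n`, where the semi-measure inequality applies. -/
theorem weight_level_succ_le {ρ : List Bool → ℝ} (hρ : IsContinuousSemimeasure ρ)
    {T : Set (List Bool)} (hT : ∀ σ b, σ ++ [b] ∈ T → σ ∈ T) (n : ℕ) :
    weight ρ (level T (n + 1)) ≤ weight ρ (level T n) := by
  rw [weight_eq_sum ρ (level_finite T (n + 1)), weight_eq_sum ρ (level_finite T n)]
  have key : ∀ τ ∈ level T (n + 1), ∃ σ b, τ = σ ++ [b] ∧ σ ∈ level T n := by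
    rintro τ ⟨hτ, hl⟩
    rcases List.eq_nil_or_concat τ with rfl | ⟨σ, b, rfl⟩
    · simp at hl
    · rw [List.concat_eq_append] at hτ hl ⊢
      exact ⟨σ, b, rfl, hT _ _ hτ, by simpa using hl⟩
  have hmaps : ∀ τ ∈ (level_finite T (n + 1)).toFinset,
      τ.dropLast ∈ (level_finite T n).toFinset := by
    intro τ hτ
    obtain ⟨σ, b, rfl, hσ⟩ := key τ (by simpa using hτ)
    simpa using hσ
  rw [← Finset.sum_fiberwise_of_maps_to hmaps]
  refine Finset.sum_le_sum fun σ _ => ?_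
  have hsub : ((level_finite T (n + 1)).toFinset.filter fun τ => τ.dropLast = σ) ⊆
      {σ ++ [false], σ ++ [true]} := by
    intro τ hτ
    rw [Finset.mem_filter] at hτ
    obtain ⟨σ', b, rfl, _⟩ := key τ (by simpa using hτ.1)
    obtain rfl : σ' = σ := by simpa using hτ.2
    cases b <;> simp
  refine (Finset.sum_le_sum_of_subset_of_nonneg hsub fun τ _ _ => (hρ.mem_Icc τ).1).trans ?_
  rw [Finset.sum_pair (by simp)]
  exact hρ.split σ

theorem weight_level_antitone {ρ : List Bool → ℝ} (hρ : IsContinuousSemimeasure ρ)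
    {T : Set (List Bool)} (hT : ∀ σ b, σ ++ [b] ∈ T → σ ∈ T) :
    Antitone fun n => weight ρ (level T n) :=
  antitone_nat_of_succ_le (weight_level_succ_le hρ hT)

theorem weight_mono {ρ : List Bool → ℝ} (hρ : IsContinuousSemimeasure ρ) {S S' : Set (List Bool)}
    (h : S ⊆ S') (hS' : S'.Finite) : weight ρ S ≤ weight ρ S' := by
  rw [weight_eq_sum ρ (hS'.subset h), weight_eq_sum ρ hS']
  exact Finset.sum_le_sum_of_subset_of_nonneg (by simpa using h) fun τ _ _ => (hρ.mem_Icc τ).1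

theorem weight_level_le_one {ρ : List Bool → ℝ} (hρ : IsContinuousSemimeasure ρ)
    (T : Set (List Bool)) (n : ℕ) : weight ρ (level T n) ≤ 1 := by
  refine (weight_mono hρ (S' := level Set.univ n) (fun σ h => ⟨trivial, h.2⟩)
    (level_finite _ _)).trans ?_
  refine (weight_level_antitone hρ (T := Set.univ) (fun _ _ _ => trivial) n.zero_le).trans ?_
  have : level Set.univ 0 = {([] : List Bool)} := by ext σ; simp [level]
  simp [this, weight, hρ.root]

theorem canonicalTree_prefix (C : Set (ℕ → Bool)) (σ : List Bool) (b : Bool)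
    (h : σ ++ [b] ∈ canonicalTree C) : σ ∈ canonicalTree C := by
  obtain ⟨X, hX, hp⟩ := h
  refine ⟨X, hX, fun i hi => ?_⟩
  rw [← hp i (by simp; omega), List.getElem_append_left hi]

/-- The strings of length `n`. -/
noncomputable def strings (n : ℕ) : Finset (List Bool) := (List.finite_length_eq Bool n).toFinset

@[simp] theorem mem_strings {n : ℕ} {σ : List Bool} : σ ∈ strings n ↔ σ.length = n := by
  simp [strings]

theorem sum_strings_le_one {ρ : List Bool → ℝ} (hρ : IsContinuousSemimeasure ρ) (n : ℕ) :
    ∑ σ ∈ strings n, ρ σ ≤ 1 := by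
  have h := weight_level_le_one hρ Set.univ n
  rw [weight_eq_sum ρ (level_finite _ n)] at h
  convert h using 2
  ext σ; simp [level]

/-- A class is deep as soon as its tree is small at computably many levels. -/
theorem isDeep_of_levels {M : List Bool → ℝ} (hM : IsContinuousSemimeasure M)
    {C : Set (ℕ → Bool)} {l : ℕ → ℕ} (hl : Computable l)
    (h : ∀ k, weight M (level (canonicalTree C) (l k)) ≤ (1 / 2 : ℝ) ^ k) : IsDeep M C := by
  -- The order rises by at most one at a time, and only when the next level `l (y + 1)` has been
  -- reached; no monotonicity of `l` is needed.
  let step : ℕ → ℕ → ℕ := fun n y => if l (y + 1) ≤ n + 1 then y + 1 else y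
  let f : ℕ → ℕ := fun n => Nat.rec 0 step n
  have hf : ∀ n, f (n + 1) = if l (f n + 1) ≤ n + 1 then f n + 1 else f n := fun _ => rfl
  have hmono : Monotone f := monotone_nat_of_le_succ fun n => by rw [hf]; split_ifs <;> omega
  refine ⟨f, ⟨?_, hmono, ?_⟩, ?_⟩
  · have hle : Computable₂ fun a b : ℕ => decide (a ≤ b) := Primrec.nat_le.decide.to_comp
    have hsucc : Computable fun p : ℕ × ℕ × ℕ => p.2.2 + 1 :=
      Computable.succ.comp (Computable.snd.comp Computable.snd)
    have hcond : Computable fun p : ℕ × ℕ × ℕ => decide (l (p.2.2 + 1) ≤ p.2.1 + 1) :=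
      hle.comp (hl.comp hsucc) (Computable.succ.comp (Computable.fst.comp Computable.snd))
    have hstep : Computable₂ fun (_ : ℕ) (p : ℕ × ℕ) => step p.1 p.2 :=
      (Computable.cond hcond hsucc (Computable.snd.comp Computable.snd)).of_eq
        fun p => by simp [step, Bool.cond_decide]
    exact Computable.nat_rec Computable.id (Computable.const 0) hstep
  · intro k
    induction k with
    | zero => exact ⟨0, Nat.zero_le _⟩
    | succ k ih =>
      obtain ⟨n, hn⟩ := ih
      by_contra! hcon
      let m := max n (l (k + 1))
      have h1 : f m = k := le_antisymm (Nat.lt_succ_iff.1 (hcon m))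
        (hn.trans (hmono (le_max_left _ _)))
      have h2 := hcon (m + 1)
      rw [hf, h1, if_pos ((le_max_right n _).trans (Nat.le_succ _))] at h2
      exact lt_irrefl _ h2
  · intro n
    -- At value `0` the trivial bound `1` suffices; otherwise level `l (f n)` has been passed and
    -- weights decrease along levels.
    have hinv : f n = 0 ∨ l (f n) ≤ n := by
      induction n with
      | zero => exact Or.inl rfl
      | succ n ih =>
        rw [hf]
        split_ifs with hc
        · exact Or.inr hc
        · exact ih.imp_right fun h => h.trans n.le_succ
    rcases hinv with h0 | hle
    · simpa [h0] using weight_level_le_one hM _ n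
    · exact (weight_level_antitone hM (canonicalTree_prefix C) hle).trans (h _)

end DeepClass
namespace DeepClass

open Nat.Partrec (Code)
open Nat.Partrec.Code (eval evaln)

/-! ### Integer approximations from below -/

/-- Rounding stage `s` down to a multiple of `2 ^ (-s)` gives all strings a common denominator, so
that weights add up as integers. The error is at most `2 ^ (-s)`, which preserves the limit. -/
theorem exists_nat_approximation {M : List Bool → ℝ} (h : IsLowerSemicomputable M) :
    ∃ N : List Bool → ℕ → ℕ, Computable₂ N ∧ (∀ σ s, (N σ s : ℝ) / 2 ^ s ≤ M σ) ∧
      ∀ σ, Filter.Tendsto (fun s => (N σ s : ℝ) / 2 ^ s) Filter.atTop (nhds (M σ)) := by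
  obtain ⟨q, hq, hlim⟩ := h
  have hle : ∀ σ s, ((q σ s).1 : ℝ) / 2 ^ (q σ s).2 ≤ M σ := fun σ s =>
    (hlim σ).1.ge_of_tendsto (hlim σ).2 s
  have hpos : ∀ n : ℕ, (0 : ℝ) < 2 ^ n := fun n => by positivity
  have hub : ∀ σ s, (((q σ s).1 * 2 ^ s / 2 ^ (q σ s).2 : ℕ) : ℝ) / 2 ^ s ≤
      ((q σ s).1 : ℝ) / 2 ^ (q σ s).2 := fun σ s => by
    rw [div_le_iff₀ (hpos s)]
    refine Nat.cast_div_le.trans (le_of_eq ?_)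
    push_cast
    ring
  have hlb : ∀ σ s, ((q σ s).1 : ℝ) / 2 ^ (q σ s).2 - (1 / 2) ^ s ≤
      (((q σ s).1 * 2 ^ s / 2 ^ (q σ s).2 : ℕ) : ℝ) / 2 ^ s := fun σ s => by
    rw [le_div_iff₀ (hpos s), sub_mul, ← mul_pow]
    have h1 := Nat.lt_div_mul_add (a := (q σ s).1 * 2 ^ s) (b := 2 ^ (q σ s).2) (by positivity)
    have h2 : (((q σ s).1 * 2 ^ s : ℕ) : ℝ) <
        (((q σ s).1 * 2 ^ s / 2 ^ (q σ s).2 : ℕ) : ℝ) * 2 ^ (q σ s).2 + 2 ^ (q σ s).2 := by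
      exact_mod_cast h1
    have h3 : ((q σ s).1 : ℝ) / 2 ^ (q σ s).2 * 2 ^ s * 2 ^ (q σ s).2 =
        (((q σ s).1 * 2 ^ s : ℕ) : ℝ) := by
      push_cast
      field_simp
    norm_num
    nlinarith [hpos (q σ s).2]
  refine ⟨fun σ s => (q σ s).1 * 2 ^ s / 2 ^ (q σ s).2, ?_, fun σ s => (hub σ s).trans (hle σ s),
    fun σ => ?_⟩
  · have hmul : Computable₂ fun a b : ℕ => a * b := Primrec.nat_mul.to_comp
    have hdiv : Computable₂ fun a b : ℕ => a / b := Primrec.nat_div.to_comp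
    have hq' : Computable fun p : List Bool × ℕ => q p.1 p.2 := hq
    exact hdiv.comp (hmul.comp (Computable.fst.comp hq') (computable_two_pow Computable.snd))
      (computable_two_pow (Computable.snd.comp hq'))
  · refine tendsto_of_tendsto_of_tendsto_of_le_of_le ?_ (hlim σ).2 (hlb σ) (hub σ)
    simpa using (hlim σ).2.sub
      (tendsto_pow_atTop_nhds_zero_of_lt_one (r := (1 / 2 : ℝ)) (by norm_num) (by norm_num))

/-! ### The diagonalization -/

/-- The standard universal partial computable `{0,1}`-valued function. -/
def universalBool (n : ℕ) : Part Bool :=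
  (eval (Denumerable.ofNat Code n.unpair.1) n.unpair.2).map fun v => decide (v = 1)

theorem partrec_universalBool : Partrec universalBool := by
  have h1 : Partrec fun n : ℕ => eval (Denumerable.ofNat Code n.unpair.1) n.unpair.2 :=
    Nat.Partrec.Code.eval_part.comp
      ((Computable.ofNat Code).comp (Computable.fst.comp Computable.unpair))
      (Computable.snd.comp Computable.unpair)
  have h2 : Computable₂ fun (_ v : ℕ) => decide (v = 1) :=
    computable_decide_eq Computable.snd (Computable.const 1)
  exact h1.map h2

/-- The place reserved by `G` for the value of the program `c` at the `j`-th input of block `k`. -/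
def place (G : ℕ → ℕ) (c : Code) (k j : ℕ) : ℕ :=
  G (Nat.pair (Encodable.encode c) (Nat.pair k j))

/-- A length exceeding all the places of block `k`. -/
def blockLength (G : ℕ → ℕ) (c : Code) (k : ℕ) : ℕ :=
  ∑ j ∈ Finset.range (2 ^ (k + 1) + 1), (place G c k j + 1)

/-- At stage `s`, the string `σ` is known to carry the values of `c` at the first `i` inputs of
block `k`. -/
def Agrees (G : ℕ → ℕ) (c : Code) (k i s : ℕ) (σ : List Bool) : Prop :=
  ∀ j < i, evaln s c (Nat.pair k j) = σ[place G c k j]?.map Bool.toNat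

/-- The test for a string of block `k` to agree with `c` at stage `s` at the first `i` inputs, and
to take the value `b` at the place of the next one. -/
def blockTest (G : ℕ → ℕ) (c : Code) (k i s : ℕ) (b : Bool) (σ : List Bool) : Bool :=
  (decide (σ.length = blockLength G c k) &&
    decide (∀ j < i, decide (evaln s c (Nat.pair k j) = σ[place G c k j]?.map Bool.toNat) = true))
    && decide (σ[place G c k i]? = some b)

theorem blockTest_iff {G : ℕ → ℕ} {c : Code} {k i s : ℕ} {b : Bool} {σ : List Bool} :
    blockTest G c k i s b σ = true ↔
      σ.length = blockLength G c k ∧ Agrees G c k i s σ ∧ σ[place G c k i]? = some b := by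
  simp [blockTest, Agrees, and_assoc]

/-- The weight at stage `s`, in units of `2 ^ (-s)`, of the strings passing the test. -/
def stageWeight (N : List Bool → ℕ → ℕ) (G : ℕ → ℕ) (c : Code) (k i s : ℕ) (b : Bool) : ℕ :=
  ∑ m ∈ Finset.range s, ((Encodable.decode m : Option (List Bool)).map fun σ =>
    if decide (Encodable.encode σ = m) && blockTest G c k i s b σ then N σ s else 0).getD 0

/-- The search condition: `m` codes a stage and the negation of the value to be returned. -/
def searchTest (N : List Bool → ℕ → ℕ) (G : ℕ → ℕ) (c : Code) (x m : ℕ) : Bool :=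
  decide (2 ^ m.div2 < stageWeight N G c x.unpair.1 x.unpair.2 m.div2 (!m.bodd) *
    2 ^ (x.unpair.1 + 1))

/-- The diagonalizing function, relative to its own program `c`. -/
def diagonal (N : List Bool → ℕ → ℕ) (G : ℕ → ℕ) (c : Code) (x : ℕ) : Part ℕ :=
  (Nat.rfind fun m => Part.some (searchTest N G c x m)).map fun m => m.bodd.toNat

section

variable {α : Type*} [Primcodable α] {G : ℕ → ℕ} (hG : Computable G)
include hG

theorem computable_place {c : α → Code} {k j : α → ℕ} (hc : Computable c) (hk : Computable k)
    (hj : Computable j) : Computable fun a => place G (c a) (k a) (j a) := by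
  have hp : Computable₂ Nat.pair := Primrec₂.natPair.to_comp
  exact hG.comp (hp.comp (Computable.encode.comp hc) (hp.comp hk hj))

theorem computable_blockLength {c : α → Code} {k : α → ℕ} (hc : Computable c)
    (hk : Computable k) : Computable fun a => blockLength G (c a) (k a) :=
  computable_sum_range (Computable.succ.comp (computable_two_pow (Computable.succ.comp hk)))
    (Computable.succ.comp (computable_place hG (hc.comp Computable.fst) (hk.comp Computable.fst)
      Computable.snd))

theorem computable_blockTest {c : α → Code} {k i s : α → ℕ} {b : α → Bool} {σ : α → List Bool}
    (hc : Computable c) (hk : Computable k) (hi : Computable i) (hs : Computable s)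
    (hb : Computable b) (hσ : Computable σ) :
    Computable fun a => blockTest G (c a) (k a) (i a) (s a) (b a) (σ a) := by
  have hp : Computable₂ Nat.pair := Primrec₂.natPair.to_comp
  have hev := Nat.Partrec.Code.primrec_evaln.to_comp
  have htn : Computable Bool.toNat := (Primrec.dom_finite _).to_comp
  have hget : Computable₂ fun (σ : List Bool) (n : ℕ) => σ[n]? := Computable.list_getElem?
  refine computable_and (computable_and
    (computable_decide_eq (Computable.list_length.comp hσ) (computable_blockLength hG hc hk))
    (computable_ball_lt hi (computable_decide_eq (α := α × ℕ) ?_ ?_)))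
    (computable_decide_eq (hget.comp hσ (computable_place hG hc hk hi))
      (Computable.option_some.comp hb))
  · exact hev.comp (((hs.comp Computable.fst).pair (hc.comp Computable.fst)).pair
      (hp.comp (hk.comp Computable.fst) Computable.snd))
  · exact Computable.option_map (hget.comp (hσ.comp Computable.fst)
      (computable_place hG (hc.comp Computable.fst) (hk.comp Computable.fst) Computable.snd))
      (htn.comp Computable.snd)

theorem computable_stageWeight {N : List Bool → ℕ → ℕ} (hN : Computable₂ N)
    {c : α → Code} {k i s : α → ℕ} {b : α → Bool} (hc : Computable c) (hk : Computable k)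
    (hi : Computable i) (hs : Computable s) (hb : Computable b) :
    Computable fun a => stageWeight N G (c a) (k a) (i a) (s a) (b a) := by
  have f : Computable fun p : (α × ℕ) × List Bool => p.1.1 :=
    Computable.fst.comp Computable.fst
  have hbody : Computable₂ fun (p : α × ℕ) (σ : List Bool) =>
      if decide (Encodable.encode σ = p.2) &&
        blockTest G (c p.1) (k p.1) (i p.1) (s p.1) (b p.1) σ then N σ (s p.1) else 0 :=
    (Computable.cond (computable_and (computable_decide_eq (Computable.encode.comp Computable.snd)
      (Computable.snd.comp Computable.fst)) (computable_blockTest hG (hc.comp f) (hk.comp f)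
      (hi.comp f) (hs.comp f) (hb.comp f) Computable.snd)) (hN.comp Computable.snd (hs.comp f))
      (Computable.const 0)).of_eq fun p => by simp [Bool.cond_eq_ite]
  exact computable_sum_range hs (Computable.option_getD
    (Computable.option_map (Computable.decode.comp Computable.snd) hbody) (Computable.const 0))

theorem partrec_diagonal {N : List Bool → ℕ → ℕ} (hN : Computable₂ N) :
    Partrec₂ (diagonal N G) := by
  have hlt : Computable₂ fun a b : ℕ => decide (a < b) := Primrec.nat_lt.decide.to_comp
  have hmul : Computable₂ fun a b : ℕ => a * b := Primrec.nat_mul.to_comp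
  have htn : Computable Bool.toNat := (Primrec.dom_finite _).to_comp
  have hnot : Computable not := Primrec.not.to_comp
  have hx : Computable fun p : (Code × ℕ) × ℕ => p.1.2.unpair :=
    Computable.unpair.comp (Computable.snd.comp Computable.fst)
  have hs : Computable fun p : (Code × ℕ) × ℕ => p.2.div2 :=
    Computable.nat_div2.comp Computable.snd
  have hk : Computable fun p : (Code × ℕ) × ℕ => p.1.2.unpair.1 := Computable.fst.comp hx
  have htest : Computable₂ fun (p : Code × ℕ) (m : ℕ) => searchTest N G p.1 p.2 m :=
    hlt.comp (computable_two_pow hs)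
      (hmul.comp (computable_stageWeight hG hN (Computable.fst.comp Computable.fst) hk
        (Computable.snd.comp hx) hs (hnot.comp (Computable.nat_bodd.comp Computable.snd)))
        (computable_two_pow (Computable.succ.comp hk)))
  exact (Partrec.rfind htest.partrec₂).map
    (htn.comp (Computable.nat_bodd.comp Computable.snd))

end

/-! ### Analysis of the diagonalization -/

theorem place_lt_blockLength (G : ℕ → ℕ) (c : Code) {k j : ℕ} (hj : j < 2 ^ (k + 1) + 1) :
    place G c k j < blockLength G c k :=
  Finset.single_le_sum (f := fun j => place G c k j + 1) (fun _ _ => Nat.zero_le _)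
    (Finset.mem_range.2 hj)

/-- The computable sum runs over codes below `s`. The check `encode σ = m` makes each string count
at most once, and the length test confines the sum to a finite set independent of `s`. -/
theorem stageWeight_eq (N : List Bool → ℕ → ℕ) (G : ℕ → ℕ) (c : Code) (k i s : ℕ) (b : Bool) :
    stageWeight N G c k i s b = ∑ σ ∈ strings (blockLength G c k),
      if Encodable.encode σ < s ∧ blockTest G c k i s b σ then N σ s else 0 := by
  have h : ∀ m, ((Encodable.decode m : Option (List Bool)).map fun σ =>
      if decide (Encodable.encode σ = m) && blockTest G c k i s b σ then N σ s else 0).getD 0 =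
      ∑ σ ∈ strings (blockLength G c k),
        if m = Encodable.encode σ then (if blockTest G c k i s b σ then N σ s else 0) else 0 := by
    intro m
    by_cases hm : ∃ τ : List Bool, Encodable.encode τ = m
    · obtain ⟨τ, rfl⟩ := hm
      simp only [Encodable.encodek, Option.map_some, Option.getD_some, Encodable.encode_inj,
        decide_true, Bool.true_and]
      rw [Finset.sum_ite_eq]
      split_ifs with h1 h2 <;> first | rfl | skip
      exact absurd (mem_strings.2 (blockTest_iff.1 h1).1) h2
    · rw [not_exists] at hm
      rw [Finset.sum_eq_zero fun σ _ => if_neg fun h => hm σ h.symm]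
      cases (Encodable.decode m : Option (List Bool)) <;> simp [hm]
  unfold stageWeight
  simp_rw [h]
  rw [Finset.sum_comm]
  refine Finset.sum_congr rfl fun σ _ => ?_
  rw [Finset.sum_ite_eq']
  simp [ite_and]

/-- The strings of block `k` that carry the values of `c` at the first `i` inputs. -/
noncomputable def agreeing (G : ℕ → ℕ) (c : Code) (k i : ℕ) : Finset (List Bool) :=
  open Classical in (strings (blockLength G c k)).filter fun σ =>
    ∀ j < i, ∃ b, σ[place G c k j]? = some b ∧ b.toNat ∈ eval c (Nat.pair k j)

theorem mem_agreeing {G : ℕ → ℕ} {c : Code} {k i : ℕ} {σ : List Bool} :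
    σ ∈ agreeing G c k i ↔ σ.length = blockLength G c k ∧
      ∀ j < i, ∃ b, σ[place G c k j]? = some b ∧ b.toNat ∈ eval c (Nat.pair k j) := by
  simp [agreeing]

/-- The places lie inside the string, so agreement cannot be the spurious equation `none = none`:
the program really has halted. -/
theorem mem_agreeing_of_agrees {G : ℕ → ℕ} {c : Code} {k i s : ℕ} {σ : List Bool}
    (hl : σ.length = blockLength G c k) (hi : i ≤ 2 ^ (k + 1) + 1) (h : Agrees G c k i s σ) :
    σ ∈ agreeing G c k i := by
  refine mem_agreeing.2 ⟨hl, fun j hj => ?_⟩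
  have hlt := place_lt_blockLength G c (hj.trans_le hi)
  have h1 := h j hj
  rw [List.getElem?_eq_getElem (hl ▸ hlt)] at h1 ⊢
  exact ⟨_, rfl, Nat.Partrec.Code.evaln_sound h1⟩

theorem eventually_agrees {G : ℕ → ℕ} {c : Code} {k i : ℕ} {σ : List Bool}
    (h : σ ∈ agreeing G c k i) : ∀ᶠ s in Filter.atTop, Agrees G c k i s σ := by
  have : ∀ j ∈ Finset.range i, ∀ᶠ s in Filter.atTop,
      evaln s c (Nat.pair k j) = σ[place G c k j]?.map Bool.toNat := by
    intro j hj
    obtain ⟨b, hb, hv⟩ := (mem_agreeing.1 h).2 j (Finset.mem_range.1 hj)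
    obtain ⟨s₀, hs₀⟩ := Nat.Partrec.Code.evaln_complete.1 hv
    filter_upwards [Filter.eventually_ge_atTop s₀] with s hs
    rw [hb]
    exact Nat.Partrec.Code.evaln_mono hs hs₀
  refine ((Finset.eventually_all _).2 this).mono fun s hs j hj => hs j (Finset.mem_range.2 hj)

variable {M : List Bool → ℝ} {N : List Bool → ℕ → ℕ} {G : ℕ → ℕ} {c : Code}

open Classical in
-- Termwise: a string that passes the test at some stage truly agrees, and its approximation is
-- below `M`.
theorem stageWeight_le (hM : IsContinuousSemimeasure M)
    (hle : ∀ σ s, (N σ s : ℝ) / 2 ^ s ≤ M σ) {k i : ℕ} (hi : i ≤ 2 ^ (k + 1) + 1) (s : ℕ)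
    (b : Bool) : (stageWeight N G c k i s b : ℝ) / 2 ^ s ≤
      ∑ σ ∈ agreeing G c k i with σ[place G c k i]? = some b, M σ := by
  rw [stageWeight_eq, Nat.cast_sum, Finset.sum_div]
  have hsub : ((agreeing G c k i).filter fun σ => σ[place G c k i]? = some b) ⊆
      strings (blockLength G c k) := fun σ h =>
    mem_strings.2 (mem_agreeing.1 (Finset.mem_filter.1 h).1).1
  rw [← Finset.inter_eq_right.2 hsub, ← Finset.sum_ite_mem]
  refine Finset.sum_le_sum fun σ hσ => ?_
  split_ifs with h1 h2 h2
  · exact hle σ s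
  · obtain ⟨hl, ha, hb⟩ := blockTest_iff.1 h1.2
    exact absurd (Finset.mem_filter.2 ⟨mem_agreeing_of_agrees hl hi ha, hb⟩) h2
  · simpa using (hM.mem_Icc σ).1
  · simp

open Classical in
-- Termwise: an agreeing string passes from some stage on, and any other string never passes.
theorem tendsto_stageWeight
    (hlim : ∀ σ, Filter.Tendsto (fun s => (N σ s : ℝ) / 2 ^ s) Filter.atTop (nhds (M σ)))
    {k i : ℕ} (hi : i ≤ 2 ^ (k + 1) + 1) (b : Bool) :
    Filter.Tendsto (fun s => (stageWeight N G c k i s b : ℝ) / 2 ^ s) Filter.atTop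
      (nhds (∑ σ ∈ agreeing G c k i with σ[place G c k i]? = some b, M σ)) := by
  simp_rw [stageWeight_eq, Nat.cast_sum, Finset.sum_div]
  have hsub : ((agreeing G c k i).filter fun σ => σ[place G c k i]? = some b) ⊆
      strings (blockLength G c k) := fun σ h =>
    mem_strings.2 (mem_agreeing.1 (Finset.mem_filter.1 h).1).1
  rw [← Finset.inter_eq_right.2 hsub, ← Finset.sum_ite_mem]
  refine tendsto_finsetSum _ fun σ hσ => ?_
  split_ifs with h2
  · refine (hlim σ).congr' ?_
    rw [Finset.mem_filter] at h2
    filter_upwards [eventually_agrees h2.1, Filter.eventually_gt_atTop (Encodable.encode σ)]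
      with s hs hlt
    rw [if_pos ⟨hlt, blockTest_iff.2 ⟨mem_strings.1 hσ, hs, h2.2⟩⟩]
  · refine tendsto_const_nhds.congr fun s => ?_
    rw [if_neg, Nat.cast_zero, zero_div]
    rintro ⟨_, h1⟩
    obtain ⟨hl, ha, hb⟩ := blockTest_iff.1 h1
    exact h2 (Finset.mem_filter.2 ⟨mem_agreeing_of_agrees hl hi ha, hb⟩)

theorem searchTest_iff {k i m : ℕ} : searchTest N G c (Nat.pair k i) m = true ↔
    (1 / 2 : ℝ) ^ (k + 1) < (stageWeight N G c k i m.div2 (!m.bodd) : ℝ) / 2 ^ m.div2 := by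
  rw [searchTest, decide_eq_true_iff, Nat.unpair_pair, lt_div_iff₀ (by positivity), one_div,
    inv_pow, inv_mul_lt_iff₀ (by positivity), mul_comm]
  exact_mod_cast Iff.rfl

theorem exists_bool_of_mem_diagonal {x v : ℕ} (h : v ∈ diagonal N G c x) :
    ∃ b : Bool, v = b.toNat := by
  obtain ⟨m, _, rfl⟩ := (Part.mem_map_iff _).1 h
  exact ⟨_, rfl⟩

/-- Each value of the diagonalizing function removes weight `2 ^ (-(k + 1))`. -/
theorem sum_agreeing_succ_le (hM : IsContinuousSemimeasure M)
    (hle : ∀ σ s, (N σ s : ℝ) / 2 ^ s ≤ M σ) (hc : eval c = diagonal N G c) {k i : ℕ}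
    (hi : i ≤ 2 ^ (k + 1) + 1) (hd : (eval c (Nat.pair k i)).Dom) :
    ∑ σ ∈ agreeing G c k (i + 1), M σ + (1 / 2) ^ (k + 1) ≤ ∑ σ ∈ agreeing G c k i, M σ := by
  classical
  obtain ⟨v, hv⟩ := Part.dom_iff_mem.1 hd
  have hv' := hv
  rw [hc] at hv'
  obtain ⟨m, hm, rfl⟩ := (Part.mem_map_iff _).1 hv'
  have ht : searchTest N G c (Nat.pair k i) m = true := by
    simpa using (Nat.rfind_spec hm)
  have h1 := (searchTest_iff.1 ht).le.trans (stageWeight_le hM hle hi m.div2 (!m.bodd))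
  -- The strings carrying the bit opposite to the output exceed the threshold in weight; those still
  -- agreeing after input `i` lie in the complement.
  rw [← Finset.sum_filter_add_sum_filter_not (agreeing G c k i)
    (fun σ => σ[place G c k i]? = some (!m.bodd)), add_comm]
  refine add_le_add h1 (Finset.sum_le_sum_of_subset_of_nonneg (fun σ hσ => ?_)
    fun σ _ _ => (hM.mem_Icc σ).1)
  obtain ⟨hl, hσ⟩ := mem_agreeing.1 hσ
  refine Finset.mem_filter.2 ⟨mem_agreeing.2 ⟨hl, fun j hj => hσ j (hj.trans i.lt_succ_self)⟩, ?_⟩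
  obtain ⟨b, hb, hbv⟩ := hσ i i.lt_succ_self
  have := Part.mem_unique hbv hv
  rw [hb]
  cases hbb : m.bodd <;> cases b <;> simp_all

/-- If the diagonalizing function diverges, then the remaining weight is small. -/
theorem sum_agreeing_le_of_not_dom
    (hlim : ∀ σ, Filter.Tendsto (fun s => (N σ s : ℝ) / 2 ^ s) Filter.atTop (nhds (M σ)))
    (hc : eval c = diagonal N G c) {k i : ℕ} (hi : i < 2 ^ (k + 1) + 1)
    (hd : ¬(eval c (Nat.pair k i)).Dom) :
    ∑ σ ∈ agreeing G c k i, M σ ≤ (1 / 2) ^ k := by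
  classical
  have hbound : ∀ b : Bool,
      ∑ σ ∈ agreeing G c k i with σ[place G c k i]? = some b, M σ ≤ (1 / 2) ^ (k + 1) := by
    intro b
    by_contra! hlt
    obtain ⟨s, hs⟩ := ((tendsto_stageWeight hlim hi.le b).eventually (lt_mem_nhds hlt)).exists
    refine hd ?_
    rw [hc]
    -- The code `Nat.bit (!b) s` stands for stage `s` with output `!b`, so the test weighs the
    -- strings carrying `b`.
    have h2 : searchTest N G c (Nat.pair k i) (Nat.bit (!b) s) = true := by
      rw [searchTest_iff]
      simpa using hs
    obtain ⟨n, hn, _⟩ := Nat.rfind_min' h2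
    exact Part.dom_iff_mem.2 ⟨_, Part.mem_map _ hn⟩
  rw [← Finset.sum_filter_add_sum_filter_not (agreeing G c k i)
    (fun σ => σ[place G c k i]? = some true)]
  have heq : (agreeing G c k i).filter (fun σ => ¬σ[place G c k i]? = some true) =
      (agreeing G c k i).filter (fun σ => σ[place G c k i]? = some false) := by
    refine Finset.filter_congr fun σ hσ => ?_
    have hlt := place_lt_blockLength G c hi
    rw [← (mem_agreeing.1 hσ).1] at hlt
    rw [List.getElem?_eq_getElem hlt]
    cases σ[place G c k i] <;> simp
  rw [heq]
  have := add_le_add (hbound true) (hbound false)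
  rw [pow_succ] at this
  linarith

/-- A class whose members compute, through `G`, total extensions of the standard universal partial
computable `{0,1}`-valued function is deep. -/
theorem isDeep_of_computes_extensions (hM : IsContinuousSemimeasure M)
    (hls : IsLowerSemicomputable M) (hG : Computable G) {C : Set (ℕ → Bool)}
    (hC : ∀ X ∈ C, ∀ n, ∀ b ∈ universalBool n, X (G n) = b) : IsDeep M C := by
  obtain ⟨N, hN, hle, hlim⟩ := exists_nat_approximation hls
  obtain ⟨c, hc⟩ := Nat.Partrec.Code.fixed_point₂ (partrec_diagonal hG hN)
  refine isDeep_of_levels hM (l := blockLength G c)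
    (computable_blockLength hG (Computable.const c) Computable.id) fun k => ?_
  -- If all `2 ^ (k + 1) + 1` inputs converged, a weight of `1 + 2 ^ (-(k + 1))` would have been
  -- removed from at most `1`.
  have hex : ∃ i, i < 2 ^ (k + 1) + 1 ∧ ¬(eval c (Nat.pair k i)).Dom := by
    by_contra! hall
    have hdec : ∀ i ≤ 2 ^ (k + 1) + 1,
        ∑ σ ∈ agreeing G c k i, M σ + i * (1 / 2) ^ (k + 1) ≤ 1 := by
      intro i
      induction i with
      | zero =>
        intro _
        have h0 : agreeing G c k 0 = strings (blockLength G c k) := by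
          ext σ; simp [mem_agreeing]
        simpa [h0] using sum_strings_le_one hM _
      | succ i ih =>
        intro hi
        have h1 := sum_agreeing_succ_le hM hle hc (Nat.le_of_succ_le hi) (hall i hi)
        have h2 := ih (Nat.le_of_succ_le hi)
        push_cast
        linarith
    have h1 := hdec _ le_rfl
    have h2 : (0 : ℝ) ≤ ∑ σ ∈ agreeing G c k (2 ^ (k + 1) + 1), M σ :=
      Finset.sum_nonneg fun σ _ => (hM.mem_Icc σ).1
    have h3 : (2 : ℝ) ^ (k + 1) * (1 / 2) ^ (k + 1) = 1 := by rw [← mul_pow]; norm_num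
    have h4 : (0 : ℝ) < (1 / 2) ^ (k + 1) := by positivity
    push_cast at h1
    linarith
  classical
  obtain ⟨hi, hd⟩ := Nat.find_spec hex
  have hmin : ∀ j < Nat.find hex, (eval c (Nat.pair k j)).Dom := fun j hj => by
    by_contra h
    exact Nat.find_min hex hj ⟨hj.trans hi, h⟩
  refine le_trans ?_ (sum_agreeing_le_of_not_dom hlim hc hi hd)
  rw [weight_eq_sum M (level_finite _ _)]
  refine Finset.sum_le_sum_of_subset_of_nonneg (fun σ hσ => ?_) fun σ _ _ => (hM.mem_Icc σ).1
  obtain ⟨⟨X, hX, hp⟩, hl⟩ := (Set.Finite.mem_toFinset _).1 hσ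
  refine mem_agreeing.2 ⟨hl, fun j hj => ?_⟩
  obtain ⟨v, hv⟩ := Part.dom_iff_mem.1 (hmin j hj)
  obtain ⟨b, rfl⟩ := exists_bool_of_mem_diagonal (hc ▸ hv)
  have hlt : place G c k j < σ.length := hl ▸ place_lt_blockLength G c (hj.trans hi)
  refine ⟨b, ?_, hv⟩
  rw [List.getElem?_eq_getElem hlt, hp _ hlt]
  -- The place is `G` of the pair of the code of `c` and the input, where `universalBool` returns
  -- the output of `c` as a bit.
  refine congrArg some (hC X hX _ b ((Part.mem_map_iff _).2 ⟨b.toNat, ?_, by cases b <;> rfl⟩))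
  simpa using hv

end DeepClass
namespace DeepClass

open FirstOrder FirstOrder.Language

/-! ### Models of arithmetic -/

section Models

variable (M : Type) [arith.Structure M]

/-- The interpretation of `0`. -/
def zeroE : M := Structure.funMap (L := arith) (M := M) ArithFunc.zero ![]

variable {M}

/-- The interpretation of the successor. -/
def succE (x : M) : M := Structure.funMap (L := arith) (M := M) ArithFunc.succ ![x]

/-- The interpretation of addition. -/
def addE (x y : M) : M := Structure.funMap (L := arith) (M := M) ArithFunc.add ![x, y]

/-- The interpretation of multiplication. -/
def mulE (x y : M) : M := Structure.funMap (L := arith) (M := M) ArithFunc.mul ![x, y]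

variable {α : Type} (v : α → M) (s t : arith.Term α)

@[simp] theorem realize_tZero : (tZero : arith.Term α).realize v = zeroE M := by
  simp only [tZero, Term.realize, zeroE]
  congr 1
  exact Subsingleton.elim _ _

@[simp] theorem realize_tSucc : (tSucc t).realize v = succE (t.realize v) := by
  simp only [tSucc, Term.realize, succE]
  congr 1
  funext i; fin_cases i; rfl

@[simp] theorem realize_tAdd : (tAdd s t).realize v = addE (s.realize v) (t.realize v) := by
  simp only [tAdd, Term.realize, addE]
  congr 1
  funext i; fin_cases i <;> rfl

@[simp] theorem realize_tMul : (tMul s t).realize v = mulE (s.realize v) (t.realize v) := by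
  simp only [tMul, Term.realize, mulE]
  congr 1
  funext i; fin_cases i <;> rfl

theorem realize_closure {n : ℕ} {φ : arith.Formula (Fin n)} :
    M ⊨ closure φ ↔ ∀ xs : Fin n → M, φ.Realize xs := by
  rw [closure, Sentence.Realize, BoundedFormula.realize_alls]
  exact forall_congr' fun xs => Formula.realize_relabel_sumInr φ

theorem realize_substLast {n m : ℕ} {φ : arith.Formula (Fin (n + 1))} {w : Fin n → Fin m}
    {t : arith.Term (Fin m)} {xs : Fin m → M} :
    (substLast φ w t).Realize xs ↔
      φ.Realize (Fin.snoc (α := fun _ => M) (xs ∘ w) (t.realize xs)) := by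
  simp only [substLast, Formula.Realize]
  rw [BoundedFormula.realize_subst, iff_eq_eq]
  congr 1
  funext i
  refine Fin.lastCases ?_ (fun j => ?_) i <;> simp

theorem realize_allLast {n : ℕ} {φ : arith.Formula (Fin (n + 1))} {xs : Fin n → M} :
    (allLast φ).Realize xs ↔ ∀ x : M, φ.Realize (Fin.snoc (α := fun _ => M) xs x) := by
  simp only [allLast, Formula.Realize]
  rw [BoundedFormula.realize_all]
  refine forall_congr' fun x => ?_
  rw [BoundedFormula.realize_relabel, iff_eq_eq]
  congr 1
  · funext i
    refine Fin.lastCases ?_ (fun j => ?_) i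
    · simp [Fin.snoc]
    · simp
  · exact Subsingleton.elim _ _

/-- Robinson's axioms, semantically. -/
structure IsRobinson (M : Type) [arith.Structure M] : Prop where
  succ_ne_zero : ∀ x : M, succE x ≠ zeroE M
  succ_inj : ∀ x y : M, succE x = succE y → x = y
  add_zero : ∀ x : M, addE x (zeroE M) = x
  add_succ : ∀ x y : M, addE x (succE y) = succE (addE x y)
  mul_zero : ∀ x : M, mulE x (zeroE M) = zeroE M
  mul_succ : ∀ x y : M, mulE x (succE y) = addE (mulE x y) x
  zero_or_succ : ∀ x : M, x = zeroE M ∨ ∃ y, x = succE y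

theorem isRobinson_of_models_peano (h : M ⊨ peano) : IsRobinson M := by
  have hax : ∀ φ, PeanoAxiom φ → M ⊨ φ := fun φ hφ => h.realize_of_mem φ hφ
  have h1 := realize_closure.1 (hax _ .succ_ne_zero)
  have h2 := realize_closure.1 (hax _ .succ_inj)
  have h3 := realize_closure.1 (hax _ .add_zero)
  have h4 := realize_closure.1 (hax _ .add_succ)
  have h5 := realize_closure.1 (hax _ .mul_zero)
  have h6 := realize_closure.1 (hax _ .mul_succ)
  refine ⟨fun x => ?_, fun x y => ?_, fun x => ?_, fun x y => ?_, fun x => ?_, fun x y => ?_, ?_⟩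
  · simpa [Formula.realize_not] using h1 ![x]
  · simpa [Formula.realize_imp] using h2 ![x, y]
  · simpa using h3 ![x]
  · simpa using h4 ![x, y]
  · simpa using h5 ![x]
  · simpa using h6 ![x, y]
  -- Induction on `x = 0 ∨ ∃ y, x = S y`, whose step holds outright without the induction
  -- hypothesis.
  · let φ : arith.Formula (Fin (0 + 1)) := ((Term.var 0).equal tZero) ⊔
      Formula.iExs (Fin 1) ((Term.var (Sum.inl 0)).equal (tSucc (Term.var (Sum.inr 0))))
    have hφ : ∀ xs : Fin (0 + 1) → M, φ.Realize xs ↔ xs 0 = zeroE M ∨ ∃ y, xs 0 = succE y := by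
      intro xs
      simp only [φ, Formula.realize_sup, Formula.realize_equal, Formula.realize_iExs,
        realize_tZero, realize_tSucc, Term.realize_var, Sum.elim_inl, Sum.elim_inr]
      refine or_congr Iff.rfl ⟨fun ⟨i, hi⟩ => ⟨_, hi⟩, fun ⟨y, hy⟩ => ⟨fun _ => y, hy⟩⟩
    have hind := realize_closure.1 (hax _ (.induction φ)) Fin.elim0
    rw [Formula.realize_imp, Formula.realize_imp, realize_substLast, realize_allLast,
      realize_allLast] at hind
    simp only [Formula.realize_imp, realize_substLast, hφ] at hind
    exact hind (by simp [Fin.snoc]) (fun x _ => by simp [Fin.snoc])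

variable (M) in
/-- The interpretation of numerals. -/
def num : ℕ → M
  | 0 => zeroE M
  | n + 1 => succE (num n)

/-! ### Numerals and their order in models of Robinson's axioms -/

namespace IsRobinson

variable (hM : IsRobinson M)
include hM

theorem add_num (m n : ℕ) : addE (num M m) (num M n) = num M (m + n) := by
  induction n with
  | zero => exact hM.add_zero _
  | succ n ih => rw [num, hM.add_succ, ih]; rfl

theorem mul_num (m n : ℕ) : mulE (num M m) (num M n) = num M (m * n) := by
  induction n with
  | zero => exact hM.mul_zero _
  | succ n ih => rw [num, hM.mul_succ, ih, hM.add_num]; rfl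

theorem num_inj {m n : ℕ} : num M m = num M n ↔ m = n := by
  refine ⟨fun h => ?_, congrArg _⟩
  induction m generalizing n with
  | zero =>
    cases n with
    | zero => rfl
    | succ n => exact absurd h.symm (hM.succ_ne_zero _)
  | succ m ih =>
    cases n with
    | zero => exact absurd h (hM.succ_ne_zero _)
    | succ n => rw [ih (hM.succ_inj _ _ h)]

/-- Addition recurses on its second argument, so successors can be peeled off `x`. This is why `x ≤
n` is expressed as `∃ z, z + x = n`, with `x` on the right. -/
theorem exists_num_of_add_eq {n : ℕ} {x z : M} (h : addE z x = num M n) :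
    ∃ m ≤ n, x = num M m := by
  induction n generalizing x with
  | zero =>
    rcases hM.zero_or_succ x with rfl | ⟨y, rfl⟩
    · exact ⟨0, le_rfl, rfl⟩
    · rw [hM.add_succ] at h
      exact absurd h (hM.succ_ne_zero _)
  | succ n ih =>
    rcases hM.zero_or_succ x with rfl | ⟨y, rfl⟩
    · exact ⟨0, Nat.zero_le _, rfl⟩
    · rw [hM.add_succ] at h
      obtain ⟨m, hm, rfl⟩ := ih (hM.succ_inj _ _ h)
      exact ⟨m + 1, Nat.succ_le_succ hm, rfl⟩

/-- Comparability with a standard numeral holds even for nonstandard `x`; the Rosser argument needs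
exactly this. -/
theorem le_or_num_le (n : ℕ) (x : M) :
    (∃ z, addE z x = num M n) ∨ ∃ z, addE z (num M n) = x := by
  induction n generalizing x with
  | zero => exact Or.inr ⟨x, hM.add_zero x⟩
  | succ n ih =>
    rcases hM.zero_or_succ x with rfl | ⟨y, rfl⟩
    · exact Or.inl ⟨num M (n + 1), hM.add_zero _⟩
    · refine (ih y).imp ?_ ?_ <;> rintro ⟨z, hz⟩ <;> refine ⟨z, ?_⟩
      · rw [hM.add_succ, hz]; rfl
      · rw [num, hM.add_succ, hz]

end IsRobinson

end Models

end DeepClass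
namespace DeepClass

open FirstOrder FirstOrder.Language

/-! ### Absolute relations -/

section Absolute

variable {α : Type}

/-- A function on tuples of naturals that is given by a term. -/
def IsTermFn (f : (α → ℕ) → ℕ) : Prop :=
  ∃ t : arith.Term α, ∀ (M : Type) [arith.Structure M], IsRobinson M →
    ∀ v : α → ℕ, t.realize (num M ∘ v) = num M (f v)

/-- A relation on tuples of naturals defined by a formula that has, in all models of Robinson's
axioms, the same truth value at numerals. -/
def Absolute (R : (α → ℕ) → Prop) : Prop :=
  ∃ φ : arith.Formula α, ∀ (M : Type) [arith.Structure M], IsRobinson M →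
    ∀ v : α → ℕ, φ.Realize (num M ∘ v) ↔ R v

namespace IsTermFn

theorem var (a : α) : IsTermFn fun v => v a :=
  ⟨Term.var a, fun _ _ _ _ => rfl⟩

theorem const (n : ℕ) : IsTermFn fun _ : α → ℕ => n := by
  induction n with
  | zero => exact ⟨tZero, fun M _ _ v => realize_tZero _⟩
  | succ n ih =>
    obtain ⟨t, ht⟩ := ih
    exact ⟨tSucc t, fun M _ hM v => by rw [realize_tSucc, ht M hM]; rfl⟩

variable {f g : (α → ℕ) → ℕ}

theorem add (hf : IsTermFn f) (hg : IsTermFn g) : IsTermFn fun v => f v + g v := by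
  obtain ⟨s, hs⟩ := hf
  obtain ⟨t, ht⟩ := hg
  exact ⟨tAdd s t, fun M _ hM v => by rw [realize_tAdd, hs M hM, ht M hM, hM.add_num]⟩

theorem mul (hf : IsTermFn f) (hg : IsTermFn g) : IsTermFn fun v => f v * g v := by
  obtain ⟨s, hs⟩ := hf
  obtain ⟨t, ht⟩ := hg
  exact ⟨tMul s t, fun M _ hM v => by rw [realize_tMul, hs M hM, ht M hM, hM.mul_num]⟩

end IsTermFn

namespace Absolute

theorem eq {f g : (α → ℕ) → ℕ} (hf : IsTermFn f) (hg : IsTermFn g) :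
    Absolute fun v => f v = g v := by
  obtain ⟨s, hs⟩ := hf
  obtain ⟨t, ht⟩ := hg
  exact ⟨s.equal t, fun M _ hM v => by
    rw [Formula.realize_equal, hs M hM, ht M hM, hM.num_inj]⟩

variable {R S : (α → ℕ) → Prop}

theorem not (hR : Absolute R) : Absolute fun v => ¬R v := by
  obtain ⟨φ, hφ⟩ := hR
  exact ⟨φ.not, fun M _ hM v => by rw [Formula.realize_not, hφ M hM]⟩

theorem and (hR : Absolute R) (hS : Absolute S) : Absolute fun v => R v ∧ S v := by
  obtain ⟨φ, hφ⟩ := hR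
  obtain ⟨ψ, hψ⟩ := hS
  exact ⟨φ ⊓ ψ, fun M _ hM v => by rw [Formula.realize_inf, hφ M hM, hψ M hM]⟩

theorem of_iff (hR : Absolute R) (h : ∀ v, S v ↔ R v) : Absolute S := by
  rwa [show S = R from funext fun v => propext (h v)]

theorem or (hR : Absolute R) (hS : Absolute S) : Absolute fun v => R v ∨ S v :=
  (hR.not.and hS.not).not.of_iff fun _ => by tauto

/-- Substitution of terms. -/
theorem subst {β : Type} {R : (β → ℕ) → Prop} (hR : Absolute R) {f : β → (α → ℕ) → ℕ}
    (hf : ∀ b, IsTermFn (f b)) : Absolute fun v => R fun b => f b v := by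
  obtain ⟨φ, hφ⟩ := hR
  choose t ht using hf
  refine ⟨BoundedFormula.subst φ t, fun M _ hM v => ?_⟩
  beta_reduce
  rw [← hφ M hM]
  simp only [Formula.Realize]
  rw [BoundedFormula.realize_subst]
  simp only [ht _ M hM]
  rfl

/-- Bounded existential quantification. -/
theorem bex {n : ℕ} {P : ℕ → (Fin n → ℕ) → Prop} {f : (Fin n → ℕ) → ℕ}
    (hP : Absolute fun w : Fin (n + 1) → ℕ => P (w 0) fun j => w j.succ) (hf : IsTermFn f) :
    Absolute fun v => ∃ i ≤ f v, P i v := by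
  obtain ⟨φ, hφ⟩ := hP
  obtain ⟨t, ht⟩ := hf
  -- Variable `0` is the witness and variable `1` the slack. Anything below a numeral is a numeral,
  -- so the matrix is only evaluated where it is absolute.
  refine ⟨Formula.iExs (Fin 2) (((tAdd (Term.var (Sum.inr 1)) (Term.var (Sum.inr 0))).equal
    (t.relabel Sum.inl)) ⊓ φ.relabel (Fin.cons (Sum.inr 0) Sum.inl)), fun M _ hM v => ?_⟩
  have hφ' : ∀ (x : M) (y : Fin 2 → M) i, y 0 = num M i →
      (φ.Realize (Sum.elim (num M ∘ v) y ∘ (Fin.cons (Sum.inr 0) Sum.inl : _ → Fin n ⊕ Fin 2)) ↔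
        P i v) := by
    intro x y i hi
    have := hφ M hM (Fin.cons i v)
    simp only [Fin.cons_zero, Fin.cons_succ] at this
    rw [← this, iff_eq_eq]
    congr 1
    funext j
    refine Fin.cases ?_ (fun j => ?_) j <;> simp [hi]
  simp only [Formula.realize_iExs, Formula.realize_inf, Formula.realize_equal, realize_tAdd,
    Term.realize_relabel, Formula.realize_relabel, Term.realize_var, Sum.elim_inr,
    Sum.elim_comp_inl, ht M hM]
  constructor
  · rintro ⟨y, hy, hy'⟩
    obtain ⟨i, hi, hi'⟩ := hM.exists_num_of_add_eq hy
    exact ⟨i, hi, (hφ' (y 0) y i hi').1 hy'⟩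
  · rintro ⟨i, hi, hP⟩
    refine ⟨![num M i, num M (f v - i)], ?_, (hφ' (num M i) _ i rfl).2 hP⟩
    simp only [Matrix.cons_val_zero, Matrix.cons_val_one]
    rw [hM.add_num, Nat.sub_add_cancel hi]

theorem ball {n : ℕ} {P : ℕ → (Fin n → ℕ) → Prop} {f : (Fin n → ℕ) → ℕ}
    (hP : Absolute fun w : Fin (n + 1) → ℕ => P (w 0) fun j => w j.succ) (hf : IsTermFn f) :
    Absolute fun v => ∀ i ≤ f v, P i v :=
  (bex (P := fun i v => ¬P i v) hP.not hf).not.of_iff fun _ => by push Not; rfl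

variable {n : ℕ} {f g h : (Fin n → ℕ) → ℕ}

theorem le (hf : IsTermFn f) (hg : IsTermFn g) : Absolute fun v => f v ≤ g v := by
  have h : Absolute fun w : Fin 2 → ℕ => ∃ i ≤ w 1, i = w 0 :=
    bex (P := fun i w => i = w 0) (eq (.var 0) (.var 1)) (.var 1)
  refine (h.subst (f := ![f, g]) (Fin.forall_fin_two.2 ⟨hf, hg⟩)).of_iff fun v => ?_
  simp

theorem lt (hf : IsTermFn f) (hg : IsTermFn g) : Absolute fun v => f v < g v :=
  le (hf.add (.const 1)) hg

theorem eq_pair (hf : IsTermFn f) (hg : IsTermFn g) (hh : IsTermFn h) :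
    Absolute fun v => h v = Nat.pair (f v) (g v) := by
  refine (((lt hf hg).and (eq hh ((hg.mul hg).add hf))).or
    ((lt hf hg).not.and (eq hh (((hf.mul hf).add hf).add hg)))).of_iff fun v => ?_
  unfold Nat.pair
  split_ifs with hc <;> simp [hc]

/-- The graph of Gödel's beta function, in terms of its two parameters. -/
theorem mod_eq (hf : IsTermFn f) (hg : IsTermFn g) (hh : IsTermFn h) :
    Absolute fun v => f v % (g v + 1) = h v := by
  have h0 : Absolute fun w : Fin 3 → ℕ => ∃ q ≤ w 0, w 0 = (w 1 + 1) * q + w 2 :=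
    bex (P := fun q w => w 0 = (w 1 + 1) * q + w 2)
      (eq (.var 1) ((((IsTermFn.var 2).add (.const 1)).mul (.var 0)).add (.var 3))) (.var 0)
  have h1 : Absolute fun w : Fin 3 → ℕ => w 2 < w 1 + 1 :=
    lt (.var 2) ((IsTermFn.var 1).add (.const 1))
  refine ((h0.and h1).subst (f := ![f, g, h])
    (by intro i; fin_cases i; exacts [hf, hg, hh])).of_iff fun v => ?_
  simp only [Matrix.cons_val]
  constructor
  · intro h
    exact ⟨⟨f v / (g v + 1), Nat.div_le_self _ _, by rw [← h, Nat.div_add_mod]⟩,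
      h ▸ Nat.mod_lt _ (Nat.succ_pos _)⟩
  · rintro ⟨⟨q, _, hq⟩, hlt⟩
    rw [hq, Nat.mul_add_mod, Nat.mod_eq_of_lt hlt]

end Absolute

/-! ### Existential relations -/

/-- Projections of absolute relations. -/
def Existential {n : ℕ} (R : (Fin n → ℕ) → Prop) : Prop :=
  ∃ P : ℕ → (Fin n → ℕ) → Prop,
    (Absolute fun w : Fin (n + 1) → ℕ => P (w 0) fun j => w j.succ) ∧ ∀ v, R v ↔ ∃ s, P s v

namespace Existential

variable {n : ℕ} {R S : (Fin n → ℕ) → Prop}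

theorem of_iff (hR : Existential R) (h : ∀ v, S v ↔ R v) : Existential S := by
  rwa [show S = R from funext fun v => propext (h v)]

theorem of_absolute (hR : Absolute R) : Existential R :=
  ⟨fun _ v => R v, hR.subst fun b => .var b.succ, fun _ => by simp⟩

theorem subst {m : ℕ} {R : (Fin m → ℕ) → Prop} (hR : Existential R)
    {f : Fin m → (Fin n → ℕ) → ℕ} (hf : ∀ b, IsTermFn (f b)) :
    Existential fun v => R fun b => f b v := by
  obtain ⟨P, hP, hRP⟩ := hR
  refine ⟨fun s v => P s fun b => f b v, ?_, fun v => hRP _⟩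
  have hf' : ∀ b, IsTermFn fun w : Fin (n + 1) → ℕ => f b fun j => w j.succ := fun b => by
    obtain ⟨t, ht⟩ := hf b
    refine ⟨t.relabel Fin.succ, fun M _ hM v => ?_⟩
    rw [← ht M hM, Term.realize_relabel]
    rfl
  exact hP.subst (f := Fin.cons (fun w => w 0) fun b w => f b fun j => w j.succ)
    (Fin.cases (.var 0) hf')

theorem and (hR : Existential R) (hS : Existential S) : Existential fun v => R v ∧ S v := by
  obtain ⟨P, hP, hRP⟩ := hR
  obtain ⟨Q, hQ, hSQ⟩ := hS
  have aux : ∀ {P : ℕ → (Fin n → ℕ) → Prop},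
      (Absolute fun w : Fin (n + 1) → ℕ => P (w 0) fun j => w j.succ) →
      Absolute fun w : Fin (n + 1) → ℕ => ∃ s ≤ w 0, P s fun j => w j.succ := fun {P} hP =>
    Absolute.bex (P := fun s w => P s fun j => w j.succ)
      (hP.subst (f := Fin.cons (fun w => w 0) fun b w => w b.succ.succ)
        (Fin.cases (.var 0) fun _ => .var _)) (.var 0)
  -- A common bound on both witnesses replaces the two unbounded quantifiers by one.
  refine ⟨fun s v => (∃ s' ≤ s, P s' v) ∧ ∃ s' ≤ s, Q s' v, (aux hP).and (aux hQ), fun v => ?_⟩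
  beta_reduce
  rw [hRP, hSQ]
  constructor
  · rintro ⟨⟨s, hs⟩, t, ht⟩
    exact ⟨max s t, ⟨s, le_max_left _ _, hs⟩, t, le_max_right _ _, ht⟩
  · rintro ⟨_, ⟨s, _, hs⟩, t, _, ht⟩
    exact ⟨⟨s, hs⟩, t, ht⟩

theorem ex {P : ℕ → (Fin n → ℕ) → Prop}
    (hP : Existential fun w : Fin (n + 1) → ℕ => P (w 0) fun j => w j.succ) :
    Existential fun v => ∃ i, P i v := by
  obtain ⟨Q, hQ, hPQ⟩ := hP
  have hPQ' : ∀ i v, P i v ↔ ∃ s, Q s (Fin.cons i v) := fun i v => by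
    simpa using hPQ (Fin.cons i v)
  refine ⟨fun b v => ∃ i ≤ b, ∃ s ≤ b, Q s (Fin.cons i v), ?_, fun v => ?_⟩
  · refine Absolute.bex (P := fun i w => ∃ s ≤ w 0, Q s (Fin.cons i fun j => w j.succ))
      (Absolute.bex (P := fun s w => Q s (Fin.cons (w 0) fun j => w j.succ.succ))
        ?_ (.var 1)) (.var 0)
    refine (hQ.subst (f := Fin.cons (fun w => w 0) (Fin.cons (fun w => w 1)
      fun b w => w b.succ.succ.succ)) (Fin.cases (.var 0) (Fin.cases (.var 1)
        fun _ => .var _))).of_iff fun w => ?_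
    rw [iff_eq_eq]
    simp only [Fin.cons_zero, Fin.cons_succ]
    congr 1
    funext j
    refine Fin.cases rfl (fun j => rfl) j
  · simp only [hPQ']
    constructor
    · rintro ⟨i, s, h⟩
      exact ⟨max i s, i, le_max_left _ _, s, le_max_right _ _, h⟩
    · rintro ⟨_, i, _, s, _, h⟩
      exact ⟨i, s, h⟩

theorem ball {P : ℕ → (Fin n → ℕ) → Prop} {f : (Fin n → ℕ) → ℕ}
    (hP : Existential fun w : Fin (n + 1) → ℕ => P (w 0) fun j => w j.succ) (hf : IsTermFn f) :
    Existential fun v => ∀ i < f v, P i v := by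
  obtain ⟨Q, hQ, hPQ⟩ := hP
  have hPQ' : ∀ i v, P i v ↔ ∃ s, Q s (Fin.cons i v) := fun i v => by
    simpa using hPQ (Fin.cons i v)
  have hf' : IsTermFn fun w : Fin (n + 1) → ℕ => f fun j => w j.succ := by
    obtain ⟨t, ht⟩ := hf
    refine ⟨t.relabel Fin.succ, fun M _ hM v => ?_⟩
    rw [← ht M hM, Term.realize_relabel]
    rfl
  have hf'' : IsTermFn fun w : Fin (n + 2) → ℕ => f fun j => w j.succ.succ := by
    obtain ⟨t, ht⟩ := hf
    refine ⟨t.relabel fun j => j.succ.succ, fun M _ hM v => ?_⟩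
    rw [← ht M hM, Term.realize_relabel]
    rfl
  -- The disjunct `¬i < f v` adapts the strict range to a bounded quantifier with `≤`.
  refine ⟨fun b v => ∀ i ≤ f v, ¬i < f v ∨ ∃ s ≤ b, Q s (Fin.cons i v), ?_, fun v => ?_⟩
  · refine Absolute.ball (P := fun i w => ¬i < f (fun j => w j.succ) ∨
      ∃ s ≤ w 0, Q s (Fin.cons i fun j => w j.succ)) ((Absolute.lt (.var 0) hf'').not.or
      (Absolute.bex (P := fun s w => Q s (Fin.cons (w 0) fun j => w j.succ.succ))
        ?_ (.var 1))) hf'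
    refine (hQ.subst (f := Fin.cons (fun w => w 0) (Fin.cons (fun w => w 1)
      fun b w => w b.succ.succ.succ)) (Fin.cases (.var 0) (Fin.cases (.var 1)
        fun _ => .var _))).of_iff fun w => ?_
    rw [iff_eq_eq]
    simp only [Fin.cons_zero, Fin.cons_succ]
    congr 1
    funext j
    refine Fin.cases rfl (fun j => rfl) j
  · simp only [hPQ']
    constructor
    · intro h
      choose! s hs using h
      -- Collection: the sum of the finitely many witnesses bounds each of them.
      refine ⟨∑ i ∈ Finset.range (f v), s i, fun i _ => or_iff_not_imp_left.2 fun hi => ?_⟩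
      rw [not_not] at hi
      exact ⟨s i, Finset.single_le_sum (f := s) (fun _ _ => Nat.zero_le _)
        (Finset.mem_range.2 hi), hs i hi⟩
    · rintro ⟨b, hb⟩ i hi
      obtain ⟨s, _, hs⟩ := (hb i hi.le).resolve_left (not_not.2 hi)
      exact ⟨s, hs⟩

end Existential

end Absolute

end DeepClass
namespace DeepClass

open FirstOrder FirstOrder.Language

/-! ### Graphs of partial recursive functions -/

/-- Partial functions with an existential graph. -/
def ExistentialGraph (f : ℕ →. ℕ) : Prop :=
  Existential fun v : Fin 2 → ℕ => v 1 ∈ f (v 0)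

theorem ExistentialGraph.app {f : ℕ →. ℕ} (hf : ExistentialGraph f) {n : ℕ}
    {a b : (Fin n → ℕ) → ℕ} (ha : IsTermFn a) (hb : IsTermFn b) :
    Existential fun v => b v ∈ f (a v) :=
  Existential.subst (R := fun v : Fin 2 → ℕ => v 1 ∈ f (v 0)) (f := ![a, b]) hf
    (Fin.forall_fin_two.2 ⟨ha, hb⟩)

theorem exists_beta_sequence (s : ℕ → ℕ) (n : ℕ) :
    ∃ p q, ∀ i ≤ n, p % ((i + 1) * q + 1) = s i := by
  let l := (List.range (n + 1)).map s
  refine ⟨(Nat.unbeta l).unpair.1, (Nat.unbeta l).unpair.2, fun i hi => ?_⟩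
  have := Nat.beta_unbeta_coe l ⟨i, by simp [l]; omega⟩
  simpa [Nat.beta, l] using this

theorem mem_prec_iff_exists_sequence {f g : ℕ →. ℕ} {a n y : ℕ} :
    y ∈ (Nat.rec (f a) (fun y IH => do let i ← IH; g (Nat.pair a (Nat.pair y i))) n : Part ℕ) ↔
      ∃ s : ℕ → ℕ, s 0 ∈ f a ∧ (∀ i < n, s (i + 1) ∈ g (Nat.pair a (Nat.pair i (s i)))) ∧
        s n = y := by
  induction n generalizing y with
  | zero =>
    constructor
    · intro h
      exact ⟨fun _ => y, h, by simp, rfl⟩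
    · rintro ⟨s, h0, _, rfl⟩
      exact h0
  | succ n ih =>
    simp only [Part.bind_eq_bind, Part.mem_bind_iff] at ih ⊢
    constructor
    · rintro ⟨i, hi, hy⟩
      obtain ⟨s, h0, hs, rfl⟩ := ih.1 hi
      refine ⟨Function.update s (n + 1) y, ?_, fun i hi => ?_, by simp⟩
      · rwa [Function.update_of_ne (by omega)]
      · rw [Function.update_of_ne (by omega : i ≠ n + 1)]
        rcases Nat.lt_succ_iff_lt_or_eq.1 hi with h | rfl
        · rw [Function.update_of_ne (by omega)]
          exact hs i h
        · rwa [Function.update_self]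
    · rintro ⟨s, h0, hs, rfl⟩
      exact ⟨s n, ih.2 ⟨s, h0, fun i hi => hs i (by omega), rfl⟩, hs n (by omega)⟩

namespace ExistentialGraph

open IsTermFn

variable {f g : ℕ →. ℕ}

theorem of_iff {R : ℕ → ℕ → Prop} (hR : Existential fun v : Fin 2 → ℕ => R (v 0) (v 1))
    (h : ∀ x y, y ∈ f x ↔ R x y) : ExistentialGraph f :=
  Existential.of_iff hR fun v => h (v 0) (v 1)

theorem pair (hf : ExistentialGraph f) (hg : ExistentialGraph g) :
    ExistentialGraph fun n => Nat.pair <$> f n <*> g n :=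
  of_iff (R := fun x y => ∃ a, ∃ b, a ∈ f x ∧ b ∈ g x ∧ y = Nat.pair a b)
    (.ex (.ex ((hf.app (.var _) (.var _)).and ((hg.app (.var _) (.var _)).and
      (.of_absolute (Absolute.eq_pair (.var _) (.var _) (.var _)))))))
    fun x y => by simp [Seq.seq, eq_comm]

theorem comp (hf : ExistentialGraph f) (hg : ExistentialGraph g) :
    ExistentialGraph fun n => g n >>= f :=
  of_iff (R := fun x y => ∃ z, z ∈ g x ∧ y ∈ f z)
    (.ex ((hg.app (.var _) (.var _)).and (hf.app (.var _) (.var _))))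
    fun _ _ => Part.mem_bind_iff

/-- The beta function codes a computation sequence by two numbers `p` and `q`. Remainders and pairs
are not terms, so auxiliary variables name them; `0 + 1` keeps the shape of the beta function. -/
theorem prec (hf : ExistentialGraph f) (hg : ExistentialGraph g) :
    ExistentialGraph (Nat.unpaired fun a n =>
      n.rec (f a) fun y IH => do let i ← IH; g (Nat.pair a (Nat.pair y i))) := by
  refine of_iff (R := fun x y => ∃ a, ∃ n, x = Nat.pair a n ∧ ∃ p, ∃ q,
    (∃ z, p % ((0 + 1) * q + 1) = z ∧ z ∈ f a) ∧
    (∀ i < n, ∃ z, ∃ z', ∃ u, ∃ w, p % ((i + 1) * q + 1) = z ∧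
      p % ((i + 1 + 1) * q + 1) = z' ∧ u = Nat.pair i z ∧ w = Nat.pair a u ∧ z' ∈ g w) ∧
    p % ((n + 1) * q + 1) = y) ?_ fun x y => ?_
  · exact .ex <| .ex <| .and (.of_absolute (Absolute.eq_pair (.var _) (.var _) (.var _))) <|
      .ex <| .ex <| .and
        (.ex (.and (.of_absolute (Absolute.mod_eq (.var _)
          (((IsTermFn.const 0).add (.const 1)).mul (.var _)) (.var _)))
          (hf.app (.var _) (.var _)))) <|
        .and (.ball (.ex <| .ex <| .ex <| .ex <| .and
          (.of_absolute (Absolute.mod_eq (.var _)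
            (((IsTermFn.var _).add (.const 1)).mul (.var _)) (.var _))) <| .and
          (.of_absolute (Absolute.mod_eq (.var _)
            ((((IsTermFn.var _).add (.const 1)).add (.const 1)).mul (.var _)) (.var _))) <| .and
          (.of_absolute (Absolute.eq_pair (.var _) (.var _) (.var _))) <| .and
          (.of_absolute (Absolute.eq_pair (.var _) (.var _) (.var _)))
          (hg.app (.var _) (.var _))) (.var _))
        (.of_absolute (Absolute.mod_eq (.var _)
          (((IsTermFn.var _).add (.const 1)).mul (.var _)) (.var _)))
  · rw [Nat.unpaired, mem_prec_iff_exists_sequence]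
    constructor
    · rintro ⟨s, h0, hs, rfl⟩
      obtain ⟨p, q, hpq⟩ := exists_beta_sequence s x.unpair.2
      exact ⟨_, _, (Nat.pair_unpair x).symm, p, q, ⟨_, hpq 0 (Nat.zero_le _), h0⟩,
        fun i hi => ⟨_, _, _, _, hpq i hi.le, hpq (i + 1) hi, rfl, rfl, hs i hi⟩, hpq _ le_rfl⟩
    · rintro ⟨a, n, rfl, p, q, ⟨_, rfl, h0⟩, hs, rfl⟩
      rw [Nat.unpair_pair]
      refine ⟨fun i => p % ((i + 1) * q + 1), h0, fun i hi => ?_, rfl⟩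
      obtain ⟨_, _, _, _, rfl, rfl, rfl, rfl, h⟩ := hs i hi
      exact h

/-- Failure at an earlier `i` is stated positively, as convergence to some `w + 1`, which keeps the
graph existential. -/
theorem rfind (hf : ExistentialGraph f) :
    ExistentialGraph fun a => Nat.rfind fun n => (fun m => m = 0) <$> f (Nat.pair a n) := by
  refine of_iff (R := fun x y => (∃ z, z = Nat.pair x y ∧ 0 ∈ f z) ∧
    ∀ i < y, ∃ z, ∃ w, z = Nat.pair x i ∧ w + 1 ∈ f z) ?_ fun x y => ?_
  · exact .and (.ex (.and (.of_absolute (Absolute.eq_pair (.var _) (.var _) (.var _)))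
      (hf.app (.var _) (.const 0)))) <| .ball (.ex <| .ex <| .and
        (.of_absolute (Absolute.eq_pair (.var _) (.var _) (.var _)))
        (hf.app (.var _) ((IsTermFn.var _).add (.const 1)))) (.var _)
  · refine Nat.mem_rfind.trans (and_congr ?_ (forall₂_congr fun i _ => ?_))
    · refine (Part.mem_map_iff _).trans ⟨?_, ?_⟩
      · rintro ⟨w, hw, h0⟩
        exact ⟨_, rfl, of_decide_eq_true h0 ▸ hw⟩
      · rintro ⟨_, rfl, h0⟩
        exact ⟨0, h0, rfl⟩
    · refine (Part.mem_map_iff _).trans ⟨?_, ?_⟩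
      · rintro ⟨w, hw, h0⟩
        obtain ⟨w, rfl⟩ := Nat.exists_eq_succ_of_ne_zero (of_decide_eq_false h0)
        exact ⟨_, w, rfl, hw⟩
      · rintro ⟨_, w, rfl, hw⟩
        exact ⟨w + 1, hw, rfl⟩

theorem of_partrec (hf : Nat.Partrec f) : ExistentialGraph f := by
  induction hf with
  | zero =>
    exact of_iff (R := fun _ y => y = 0) (.of_absolute (.eq (.var _) (.const 0)))
      fun x y => Part.mem_some_iff
  | succ =>
    exact of_iff (R := fun x y => y = x + 1)
      (.of_absolute (.eq (.var _) ((IsTermFn.var _).add (.const 1)))) fun x y => Part.mem_some_iff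
  | left =>
    refine of_iff (R := fun x y => ∃ z, x = Nat.pair y z)
      (.ex (.of_absolute (Absolute.eq_pair (.var _) (.var _) (.var _)))) fun x y => ?_
    refine Part.mem_some_iff.trans ⟨fun h => ⟨x.unpair.2, by simp [h]⟩, ?_⟩
    rintro ⟨z, rfl⟩; simp
  | right =>
    refine of_iff (R := fun x y => ∃ z, x = Nat.pair z y)
      (.ex (.of_absolute (Absolute.eq_pair (.var _) (.var _) (.var _)))) fun x y => ?_
    refine Part.mem_some_iff.trans ⟨fun h => ⟨x.unpair.1, by simp [h]⟩, ?_⟩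
    rintro ⟨z, rfl⟩; simp
  | pair _ _ hf hg => exact hf.pair hg
  | comp _ _ hf hg => exact hf.comp hg
  | prec _ _ hf hg => exact hf.prec hg
  | rfind _ hf => exact hf.rfind

end ExistentialGraph

end DeepClass
namespace DeepClass

open FirstOrder FirstOrder.Language

/-! ### Rosser formulas -/

/-- Every partial computable `{0,1}`-valued function is decided, where it is defined, by a
single formula evaluated at numerals. -/
theorem exists_deciding_formula {f : ℕ →. Bool} (hf : Partrec f) :
    ∃ φ : arith.Formula (Fin 1), ∀ (M : Type) [arith.Structure M], IsRobinson M →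
      ∀ n, ∀ b ∈ f n, (φ.Realize (fun _ => num M n) ↔ b = true) := by
  have htn : Computable₂ fun (_ : ℕ) (b : Bool) => b.toNat :=
    ((Primrec.dom_finite Bool.toNat).to_comp.comp Computable.snd :
      Computable fun p : ℕ × Bool => p.2.toNat)
  obtain ⟨Q, hQ, hfQ⟩ := ExistentialGraph.of_partrec (Partrec.nat_iff.1 (hf.map htn))
  have habs : ∀ b : Bool, Absolute fun w : Fin 2 → ℕ => Q (w 0) ![w 1, b.toNat] := fun b => by
    refine (hQ.subst (f := ![fun w : Fin 2 → ℕ => w 0, fun w => w 1, fun _ => b.toNat])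
      (by intro i; fin_cases i; exacts [.var 0, .var 1, .const _])).of_iff fun w => ?_
    rw [iff_eq_eq]
    congr 1
    funext i
    fin_cases i <;> rfl
  obtain ⟨φ₁, h₁⟩ := habs true
  obtain ⟨φ₀, h₀⟩ := habs false
  have hval : ∀ n (b : Bool), b ∈ f n ↔ ∃ s, Q s ![n, b.toNat] := fun n b => by
    rw [← hfQ ![n, b.toNat] ]
    refine Iff.trans ?_ (Part.mem_map_iff _).symm
    constructor
    · intro h
      exact ⟨b, h, rfl⟩
    · rintro ⟨b', h, hb⟩
      have hb' : b'.toNat = b.toNat := hb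
      have : b' = b := by
        cases b <;> cases b' <;> first | rfl | exact absurd hb' (by decide)
      exact this ▸ h
  let ψ₀ : arith.Formula ((Fin 1 ⊕ Fin 1) ⊕ Fin 2) :=
    ((tAdd (Term.var (Sum.inr 1)) (Term.var (Sum.inr 0))).equal (Term.var (Sum.inl (Sum.inr 0)))) ⊓
      φ₀.relabel ![Sum.inr 0, Sum.inl (Sum.inl 0)]
  let ψ₁ : arith.Formula (Fin 1 ⊕ Fin 1) := φ₁.relabel ![Sum.inr 0, Sum.inl 0]
  -- Rosser's trick: some `y` witnesses the value `1`, and nothing at or below `y` witnesses the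
  -- value `0`.
  refine ⟨Formula.iExs (Fin 1) (ψ₁ ⊓ (Formula.iExs (Fin 2) ψ₀).not), fun M _ hM n b hb => ?_⟩
  have hvec : ∀ s, (num M ∘ ![s, n] : Fin 2 → M) = ![num M s, num M n] := fun s => by
    funext i; fin_cases i <;> rfl
  have h₁' : ∀ s, φ₁.Realize ![num M s, num M n] ↔ Q s ![n, 1] := fun s => by
    rw [← hvec]; exact h₁ M hM ![s, n]
  have h₀' : ∀ s, φ₀.Realize ![num M s, num M n] ↔ Q s ![n, 0] := fun s => by
    rw [← hvec]; exact h₀ M hM ![s, n]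
  have hψ₁ : ∀ y : Fin 1 → M, ψ₁.Realize (Sum.elim (fun _ => num M n) y) ↔
      φ₁.Realize ![y 0, num M n] := fun y => by
    rw [Formula.realize_relabel, iff_eq_eq]
    congr 1
    funext i; fin_cases i <;> rfl
  have hψ₀ : ∀ (y : Fin 1 → M) (z : Fin 2 → M),
      ψ₀.Realize (Sum.elim (Sum.elim (fun _ => num M n) y) z) ↔
        addE (z 1) (z 0) = y 0 ∧ φ₀.Realize ![z 0, num M n] := fun y z => by
    rw [Formula.realize_inf, Formula.realize_equal, realize_tAdd, Formula.realize_relabel]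
    refine and_congr Iff.rfl ?_
    rw [iff_eq_eq]
    congr 1
    funext i; fin_cases i <;> rfl
  simp only [Formula.realize_iExs, Formula.realize_inf, Formula.realize_not, hψ₁, hψ₀]
  constructor
  · rintro ⟨y, hy, hno⟩
    by_contra hbf
    obtain rfl : b = false := by simpa using hbf
    obtain ⟨t, ht⟩ := (hval n false).1 hb
    -- Either `y ≤ t`, so `y` is standard and `f n` would also be `true`, or `t ≤ y`, and `t` is a
    -- forbidden witness for `0`.
    rcases hM.le_or_num_le t (y 0) with ⟨z, hz⟩ | ⟨z, hz⟩
    · obtain ⟨s, _, hs⟩ := hM.exists_num_of_add_eq hz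
      rw [hs, h₁'] at hy
      exact Bool.noConfusion (Part.mem_unique hb ((hval n true).2 ⟨s, hy⟩))
    · exact hno ⟨![num M t, z], hz, (h₀' t).2 ht⟩
  · rintro rfl
    obtain ⟨s, hs⟩ := (hval n true).1 hb
    refine ⟨fun _ => num M s, (h₁' s).2 hs, ?_⟩
    rintro ⟨z, hz, hz'⟩
    obtain ⟨t, _, ht⟩ := hM.exists_num_of_add_eq hz
    rw [ht, h₀'] at hz'
    exact Bool.noConfusion (Part.mem_unique hb ((hval n false).2 ⟨t, hz'⟩))

/-! ### Gödel numbers -/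

theorem codeTerm_injective {n : ℕ} :
    Function.Injective (codeTerm : arith.Term (Empty ⊕ Fin n) → ℕ) := by
  intro t
  induction t with
  | var a =>
    rcases a with a | a
    · exact a.elim
    · intro s h
      rcases s with (b | b) | ⟨f, ts⟩
      · exact b.elim
      · simpa [codeTerm, Fin.ext_iff] using h
      · cases f <;> simp [codeTerm, codeFunc] at h
  | func f ts ih =>
    intro s h
    rcases s with (b | b) | ⟨g, us⟩
    · exact b.elim
    · cases f <;> simp [codeTerm, codeFunc] at h
    · cases f <;> cases g <;> simp [codeTerm, codeFunc] at h <;> congr 1 <;> funext i <;>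
        fin_cases i
      · exact ih _ h
      · exact ih _ h.1
      · exact ih _ h.2
      · exact ih _ h.1
      · exact ih _ h.2

theorem codeFormula_injective {n : ℕ} :
    Function.Injective (codeFormula : arith.BoundedFormula Empty n → ℕ) := by
  intro φ
  induction φ with
  | falsum =>
    intro ψ h
    cases ψ with
    | rel R => exact Empty.elim R
    | falsum => rfl
    | _ => simp [codeFormula] at h
  | equal t s =>
    intro ψ h
    cases ψ with
    | rel R => exact Empty.elim R
    | equal t' s' =>
      simp only [codeFormula, Nat.pair_eq_pair, true_and] at h
      rw [codeTerm_injective h.1, codeTerm_injective h.2]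
    | _ => simp [codeFormula] at h
  | rel R => exact Empty.elim R
  | imp φ₁ φ₂ ih₁ ih₂ =>
    intro ψ h
    cases ψ with
    | rel R => exact Empty.elim R
    | imp ψ₁ ψ₂ =>
      simp only [codeFormula, Nat.pair_eq_pair, true_and] at h
      rw [ih₁ h.1, ih₂ h.2]
    | _ => simp [codeFormula] at h
  | all φ ih =>
    intro ψ h
    cases ψ with
    | rel R => exact Empty.elim R
    | all ψ =>
      simp only [codeFormula, Nat.pair_eq_pair, true_and] at h
      rw [ih h]
    | _ => simp [codeFormula] at h

/-- Numerals as terms. -/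
def tNum {α : Type} : ℕ → arith.Term α
  | 0 => tZero
  | n + 1 => tSucc (tNum n)

theorem realize_tNum {α M : Type} [arith.Structure M] (v : α → M) (n : ℕ) :
    (tNum n : arith.Term α).realize v = num M n := by
  induction n with
  | zero => exact realize_tZero v
  | succ n ih => rw [tNum, realize_tSucc, ih]; rfl

/-- The sentence `∀ x, x = n → φ(x)`. -/
def instanceAt (φ : arith.Formula (Fin 1)) (n : ℕ) : arith.Sentence :=
  BoundedFormula.all (BoundedFormula.imp
    (BoundedFormula.equal (Term.var (Sum.inr (0 : Fin 1))) (tNum n))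
    (BoundedFormula.relabel (Sum.inr : Fin 1 → Empty ⊕ Fin 1) φ : arith.BoundedFormula Empty 1))

theorem realize_instanceAt {M : Type} [arith.Structure M] {φ : arith.Formula (Fin 1)} {n : ℕ} :
    M ⊨ instanceAt φ n ↔ φ.Realize fun _ => num M n := by
  have h : ∀ x : M, BoundedFormula.Realize (BoundedFormula.imp
      (BoundedFormula.equal (Term.var (Sum.inr (0 : Fin 1))) (tNum n))
      (BoundedFormula.relabel (Sum.inr : Fin 1 → Empty ⊕ Fin 1) φ :
        arith.BoundedFormula Empty 1)) default (fun _ => x) ↔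
      (x = num M n → φ.Realize fun _ => x) := fun x => by
    rw [BoundedFormula.realize_imp]
    refine imp_congr ?_ (Formula.realize_relabel_sumInr φ)
    simp only [BoundedFormula.Realize, realize_tNum]
    rfl
  have h' : M ⊨ instanceAt φ n ↔ ∀ x : M, x = num M n → φ.Realize fun _ => x := by
    rw [instanceAt, Sentence.Realize, Formula.Realize, BoundedFormula.realize_all]
    refine forall_congr' fun x => ?_
    rw [← h x, iff_eq_eq]
    congr 1
  rw [h']
  exact ⟨fun h => h _ rfl, fun h x hx => hx ▸ h⟩

/-- Since `n` enters `instanceAt` only through one numeral, with no substitution into `φ`, the code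
is a fixed pairing expression in the code of that numeral. -/
theorem computable_godelNumber_instanceAt (φ : arith.Formula (Fin 1)) :
    Computable fun n => godelNumber (instanceAt φ n) := by
  have hnum : Primrec fun n => codeTerm (tNum n : arith.Term (Empty ⊕ Fin 1)) := by
    have hstep : Primrec₂ fun (_ : ℕ) (y : ℕ) => Nat.pair 2 y :=
      Primrec₂.natPair.comp (Primrec.const 2) Primrec.snd
    refine (Primrec.nat_rec₁ (Nat.pair 1 0) hstep).of_eq fun n => ?_
    induction n with
    | zero => rfl
    | succ n ih => exact congrArg (Nat.pair 2) ih
  have h : Primrec fun n => Nat.pair 3 (Nat.pair 2 (Nat.pair (Nat.pair 1 (Nat.pair (Nat.pair 0 0)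
      (codeTerm (tNum n : arith.Term (Empty ⊕ Fin 1)))))
      (codeFormula (BoundedFormula.relabel (Sum.inr : Fin 1 → Empty ⊕ Fin 1) φ :
        arith.BoundedFormula Empty 1)))) :=
    Primrec₂.natPair.comp (Primrec.const 3) (Primrec₂.natPair.comp (Primrec.const 2)
      (Primrec₂.natPair.comp (Primrec₂.natPair.comp (Primrec.const 1)
        (Primrec₂.natPair.comp (Primrec.const _) hnum)) (Primrec.const _)))
  exact h.to_comp

/-! ### Completions of Peano arithmetic as theories of models -/

/-- A model of a complete theory satisfies nothing outside it, since the negation would be in the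
theory; injectivity of Gödel numbers lets `X` be read sentence by sentence. -/
theorem exists_model_of_mem_consistentCompletionsPA {X : ℕ → Bool}
    (hX : X ∈ consistentCompletionsPA) : ∃ (M : Type) (_ : arith.Structure M),
      M ⊨ peano ∧ ∀ φ : arith.Sentence, X (godelNumber φ) = true ↔ M ⊨ φ := by
  obtain ⟨T, hT, ⟨⟨M⟩, hmax⟩, hX⟩ := hX
  have hM : ∀ φ ∈ T, M ⊨ φ := fun φ hφ => Theory.realize_sentence_of_mem T hφ
  refine ⟨M, inferInstance, ⟨fun φ hφ => hM φ (hT hφ)⟩, fun φ => ?_⟩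
  rw [hX]
  constructor
  · rintro ⟨ψ, hψ, h⟩
    exact codeFormula_injective h ▸ hM ψ hψ
  · intro h
    refine ⟨φ, (hmax φ).resolve_right fun hn => ?_, rfl⟩
    exact (Sentence.realize_not M).1 (hM _ hn) h

theorem isDeep_consistentCompletionsPA {M : List Bool → ℝ} (hM : IsContinuousSemimeasure M)
    (hls : IsLowerSemicomputable M) : IsDeep M consistentCompletionsPA := by
  obtain ⟨φ, hφ⟩ := exists_deciding_formula partrec_universalBool
  refine isDeep_of_computes_extensions hM hls (computable_godelNumber_instanceAt φ) ?_
  intro X hX n b hb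
  obtain ⟨A, _, hA, hXA⟩ := exists_model_of_mem_consistentCompletionsPA hX
  rw [Bool.eq_iff_iff, hXA, realize_instanceAt]
  exact hφ A (isRobinson_of_models_peano hA) n b hb

/-! ### Total extensions -/

theorem isPi01Class_totalExtensions {u : ℕ →. Bool} (hu : Partrec u) :
    IsPi01Class (totalExtensions u) := by
  -- A string is forbidden when its last bit contradicts `u`. For the empty string the position
  -- truncates to `0`, where no bit exists, so it is never forbidden.
  let S : Set (List Bool) := {σ | ∃ b, σ[σ.length - 1]? = some b ∧ (!b) ∈ u (σ.length - 1)}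
  refine ⟨S, ?_, ?_⟩
  · have hlen : Computable fun σ : List Bool => σ.length - 1 :=
      Computable.pred.comp Computable.list_length
    have hget : Computable₂ fun (σ : List Bool) (n : ℕ) => σ[n]? := Computable.list_getElem?
    have hor : Computable₂ fun a b : Option Bool => decide (a = b) :=
      Primrec.eq.decide.to_comp
    have hnot : Computable not := Primrec.not.to_comp
    have hcond : Computable fun p : List Bool × Bool =>
        decide (p.1[p.1.length - 1]? = some (!p.2)) :=
      hor.comp (hget.comp Computable.fst (hlen.comp Computable.fst))
        (Computable.option_some.comp (hnot.comp Computable.snd))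
    have hbody : Partrec₂ fun (σ : List Bool) (b : Bool) =>
        bif decide (σ[σ.length - 1]? = some (!b)) then Part.some () else Part.none :=
      Partrec.cond hcond (Computable.const ()).partrec Partrec.none
    refine ((hu.comp hlen).bind hbody).dom_re.of_eq fun σ => ?_
    rw [Part.dom_iff_mem]
    simp only [Part.mem_bind_iff]
    constructor
    · rintro ⟨_, b, hb, h⟩
      refine ⟨!b, ?_, by simpa using hb⟩
      by_contra hne
      simp [hne] at h
    · rintro ⟨b, h1, h2⟩
      exact ⟨(), !b, h2, by simp [h1]⟩
  · ext X
    simp only [totalExtensions, Set.mem_ofPred_eq, Set.mem_compl_iff, not_exists, not_and]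
    constructor
    · rintro h σ ⟨b, hb, hu⟩ hp
      obtain ⟨hlt, hb⟩ := List.getElem?_eq_some_iff.1 hb
      have := h _ _ hu
      rw [← hp _ hlt, hb] at this
      cases b <;> simp at this
    · intro h n b hb
      by_contra hne
      refine h (List.ofFn fun i : Fin (n + 1) => X i) ⟨X n, by simp [-List.ofFn_succ], ?_⟩
        fun i hi => by simp [-List.ofFn_succ]
      have : (!X n) = b := by cases b <;> simpa using hne
      simpa [this] using hb

end DeepClass

/-! ### The main theorem -/

theorem mainTheorem7
    (φ : ℕ → ℕ →. Bool) (hφ : DeepClass.IsEffectiveEnumeration φ)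
    (u : ℕ →. Bool) (hu : DeepClass.IsUniversalFor u φ)
    (M : List Bool → ℝ) (hM : DeepClass.IsUniversalSemimeasure M) :
    DeepClass.IsPi01Class (DeepClass.totalExtensions u) ∧
      DeepClass.IsDeep M (DeepClass.totalExtensions u) ∧
      DeepClass.IsDeep M DeepClass.consistentCompletionsPA := by
  refine ⟨DeepClass.isPi01Class_totalExtensions hu.partrec, ?_,
    DeepClass.isDeep_consistentCompletionsPA hM.semimeasure hM.lowerSemicomputable⟩
  obtain ⟨g, hg, hgu⟩ := hu.simulates
  obtain ⟨e, he⟩ := hφ.exhaustive _ DeepClass.partrec_universalBool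
  -- Here `G` is `g e` for an index `e` of `universalBool` in the enumeration.
  refine DeepClass.isDeep_of_computes_extensions hM.semimeasure hM.lowerSemicomputable
    (hg.comp (Computable.const e) Computable.id) fun X hX n b hb => hX _ b ?_
  rwa [id, hgu, he]
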